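/- **Setting.** Let $\Omega\subset\mathbb{R}^d$ be a bounded open set with Lipschitz boundary (near each boundary point, $\Omega$ is the part strictly below the graph of a Lipschitz function in suitable orthonormal coordinates; connectedness is not required). Let $\mathrm{d}\Gamma$ be the surface measure ($(d-1)$-dimensional Hausdorff measure) on $\partial\Omega$ and $\widehat{\mathbf n}$ the outward unit normal, which exists $\mathrm{d}\Gamma$-almost everywhere. Let $\partial\Omega=\Gamma^p\cup\Gamma^v$ with $\Gamma^p,\Gamma^v$ disjoint and measurable (either may be empty). Let $\mu_0>0$, $\beta\ge 0$, $p_0\neq 0$ be constants, $\xi$ a real-valued function (the potential of the body force), and $\mathbf K$ a field of symmetric $d\times d$ matrices with $k_1|\zeta|^2\le \zeta\cdot\mathbf K(x)\zeta\le k_2|\zeta|^2$ for all $x\in\Omega$, $\zeta\in\mathbb{R}^d$, where $0<k_1\le k_2$ are constants. Put $$\widetilde\mu_0(x)=\mu_0\exp\!\Big[-\frac{\beta\,\xi(x)}{p_0}\Big],\qquad g(q)=\exp\!\Big[\beta\Big(\frac{q}{p_0}-1\Big)\Big].$$ A *solution* of the Barus boundary value problem with data $(\widetilde p_{\rm p},v_n)$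 is a pair $(\widetilde p,\mathbf v)$ with $\widetilde p\in H^1(\Omega)$ bounded and $\mathbf v\in L^2(\Omega;\mathbb{R}^d)$ such that $$\widetilde\mu_0\, g(\widetilde p)\,\mathbf K^{-1}\mathbf v+\operatorname{grad}\widetilde p=\mathbf 0 \ \text{ a.e. in }\Omega,\qquad \operatorname{div}\mathbf v=0\ \text{ in }\Omega,$$ $$\widetilde p=\widetilde p_{\rm p}\ \ \mathrm{d}\Gamma\text{-a.e. on }\Gamma^p,\qquad \mathbf v\cdot\widehat{\mathbf n}=v_n\ \ \mathrm{d}\Gamma\text{-a.e. on }\Gamma^v,$$ with $\operatorname{grad}$ the weak gradient and $\operatorname{div}$ taken in the sense of distributions. The boundary values are attained continuously off a small set: there is a closed $S\subset\partial\Omega$ of finite $(d-2)$-dimensional Hausdorff measure (empty if $d=1$) such that $\widetilde p$ and $\mathbf v$, as functions on $\overline\Omega$, are continuous at every point of $\partial\Omega\setminus S$; moreover $\mathbf v\cdot\widehat{\mathbf n}$ is integrable on $\partial\Omega$. (The set $S$ allows for corners, edges and the interface between $\Gamma^p$ and $\Gamma^v$.) **Theorem (reciprocal relation for the Barus model).**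 Let $(\widetilde p^{(1)},\mathbf v^{(1)})$ and $(\widetilde p^{(2)},\mathbf v^{(2)})$ be solutions with data $(\widetilde p^{(1)}_{\rm p},v^{(1)}_n)$ and $(\widetilde p^{(2)}_{\rm p},v^{(2)}_n)$, respectively, for the same $\Omega,\Gamma^p,\Gamma^v,\mu_0,\beta,p_0,\xi,\mathbf K$. Then $$\int_{\Gamma^v} v_n^{(2)}\,e^{-\beta\left(\widetilde p^{(1)}/p_0-1\right)}\,\mathrm{d}\Gamma-\int_{\Gamma^p} e^{-\beta\left(\widetilde p^{(2)}_{\rm p}/p_0-1\right)}\,\mathbf v^{(1)}\cdot\widehat{\mathbf n}\,\mathrm{d}\Gamma =\int_{\Gamma^v} v_n^{(1)}\,e^{-\beta\left(\widetilde p^{(2)}/p_0-1\right)}\,\mathrm{d}\Gamma-\int_{\Gamma^p} e^{-\beta\left(\widetilde p^{(1)}_{\rm p}/p_0-1\right)}\,\mathbf v^{(2)}\cdot\widehat{\mathbf n}\,\mathrm{d}\Gamma .$$ -/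

import Mathlib

open MeasureTheory Set Filter Topology
open scoped ContDiff Gradient

namespace BarusFlow

noncomputable section

/-- `ℝᵈ` with the Euclidean norm and inner product. -/
abbrev Space (d : ℕ) : Type := EuclideanSpace ℝ (Fin d)

/-- Near each of its boundary points, `Ω` is the part lying strictly below the graph of a Lipschitz
function `φ` of the coordinates orthogonal to some unit vector `e` (only the values of `φ` at the
projections `y - ⟪e, y⟫ e` matter). -/
def HasLipschitzBoundary {d : ℕ} (Ω : Set (Space d)) : Prop :=
  ∀ x ∈ frontier Ω, ∃ e : Space d, ‖e‖ = 1 ∧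
    ∃ φ : Space d → ℝ, (∃ L, LipschitzWith L φ) ∧
      ∃ U ∈ 𝓝 x, ∀ y ∈ U, (y ∈ Ω ↔ inner ℝ e y < φ (y - inner ℝ e y • e))

/-- A bounded Lipschitz domain (not necessarily connected). -/
structure IsBoundedLipschitzDomain {d : ℕ} (Ω : Set (Space d)) : Prop where
  isOpen : IsOpen Ω
  isBounded : Bornology.IsBounded Ω
  lipschitz : HasLipschitzBoundary Ω

/-- The surface measure `dΓ` on `∂Ω`: the `(d-1)`-dimensional Hausdorff measure, normalised so that
it agrees with Lebesgue measure on hyperplanes. -/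
def surfaceMeasure {d : ℕ} (Ω : Set (Space d)) : Measure (Space d) :=
  (Measure.euclideanHausdorffMeasure (d - 1)).restrict (frontier Ω)

/-- `ν` is the outward unit normal of `Ω` at the boundary point `x`: the half-space
`{y | ⟪y - x, ν⟫ < 0}` is tangent to `Ω` at `x`. -/
def IsOutwardUnitNormal {d : ℕ} (Ω : Set (Space d)) (x ν : Space d) : Prop :=
  ‖ν‖ = 1 ∧ ∀ ε : ℝ, 0 < ε → ∀ᶠ y in 𝓝 x,
    (inner ℝ (y - x) ν < -(ε * ‖y - x‖) → y ∈ Ω) ∧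
    (ε * ‖y - x‖ < inner ℝ (y - x) ν → y ∉ Ω)

open Classical in
/-- The outward unit normal field `n̂`; it takes the value `0` where there is no normal. -/
def outwardNormal {d : ℕ} (Ω : Set (Space d)) (x : Space d) : Space d :=
  if h : ∃ ν, IsOutwardUnitNormal Ω x ν then h.choose else 0

/-- Smooth functions with compact support in `Ω`. -/
structure IsTestFunction {d : ℕ} (Ω : Set (Space d)) (φ : Space d → ℝ) : Prop where
  smooth : ContDiff ℝ ∞ φ
  hasCompactSupport : HasCompactSupport φ
  tsupport_subset : tsupport φ ⊆ Ω

/-- `G` is the weak gradient of `u` in `Ω`. -/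
def IsWeakGradient {d : ℕ} (Ω : Set (Space d)) (u : Space d → ℝ) (G : Space d → Space d) : Prop :=
  LocallyIntegrableOn u Ω ∧ LocallyIntegrableOn G Ω ∧
    ∀ φ, IsTestFunction Ω φ → ∫ x in Ω, u x • ∇ φ x = - ∫ x in Ω, φ x • G x

/-- `div v = 0` in `Ω`, in the sense of distributions. -/
def IsWeaklyDivergenceFree {d : ℕ} (Ω : Set (Space d)) (v : Space d → Space d) : Prop :=
  LocallyIntegrableOn v Ω ∧
    ∀ φ, IsTestFunction Ω φ → ∫ x in Ω, inner ℝ (v x) (∇ φ x) = 0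

/-- A permeability field: symmetric, bounded and uniformly elliptic in `Ω`. -/
structure IsPermeability {d : ℕ} (Ω : Set (Space d))
    (K : Space d → Matrix (Fin d) (Fin d) ℝ) : Prop where
  symm : ∀ x ∈ Ω, (K x).IsSymm
  elliptic : ∃ k₁ k₂ : ℝ, 0 < k₁ ∧ k₁ ≤ k₂ ∧ ∀ x ∈ Ω, ∀ ζ : Space d,
    k₁ * inner ℝ ζ ζ ≤ inner ℝ ζ (Matrix.toEuclideanLin (K x) ζ) ∧
    inner ℝ ζ (Matrix.toEuclideanLin (K x) ζ) ≤ k₂ * inner ℝ ζ ζ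

/-- `μ̃₀(x) = μ₀ exp(-β ξ(x) / p₀)`. -/
def viscosityCoeff {d : ℕ} (μ₀ β p₀ : ℝ) (ξ : Space d → ℝ) (x : Space d) : ℝ :=
  μ₀ * Real.exp (-(β * ξ x / p₀))

/-- `g(q) = exp(β (q / p₀ - 1))`. -/
def barusFactor (β p₀ q : ℝ) : ℝ :=
  Real.exp (β * (q / p₀ - 1))

/-- `(p, v)` is a finite-energy solution of the Barus boundary value problem
```
μ̃₀ g(p) K⁻¹ v + grad p = 0   in Ω,      p = pp      on Γp,
div v = 0                     in Ω,      v · n̂ = vn  on Γv,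
```
where `p` is the modified pressure (pressure plus the potential `ξ` of the body force).
The differential equations hold in the weak sense.  The fields attain their boundary values
continuously, except at a closed set `S ⊆ ∂Ω` of finite `(d-2)`-dimensional measure, which may
contain corners, edges and the interface between `Γp` and `Γv`; there `v` may be unbounded. -/
structure IsBarusSolution {d : ℕ} (Ω : Set (Space d)) (μ₀ β p₀ : ℝ) (ξ : Space d → ℝ)
    (K : Space d → Matrix (Fin d) (Fin d) ℝ) (Γp Γv : Set (Space d))
    (pp vn : Space d → ℝ) (p : Space d → ℝ) (v : Space d → Space d) : Prop where
  /-- The modified pressure is bounded and the velocity is square integrable in `Ω`. -/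
  bounded_p : ∃ M : ℝ, ∀ x ∈ Ω, |p x| ≤ M
  memLp_v : MemLp v 2 (volume.restrict Ω)
  /-- `p` is in the Sobolev space `H¹(Ω)`, and balance of linear momentum holds. -/
  memLp_p : MemLp p 2 (volume.restrict Ω)
  momentum : ∃ G : Space d → Space d, MemLp G 2 (volume.restrict Ω) ∧ IsWeakGradient Ω p G ∧
    ∀ᵐ x ∂(volume.restrict Ω),
      (viscosityCoeff μ₀ β p₀ ξ x * barusFactor β p₀ (p x)) •
        Matrix.toEuclideanLin (K x)⁻¹ (v x) + G x = 0
  /-- Balance of mass. -/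
  mass : IsWeaklyDivergenceFree Ω v
  /-- Boundary values. -/
  boundary : ∃ S : Set (Space d), IsClosed S ∧ S ⊆ frontier Ω ∧
    Measure.hausdorffMeasure ((d : ℝ) - 2) S < ⊤ ∧
    ∀ x ∈ frontier Ω \ S,
      ContinuousWithinAt p (closure Ω) x ∧ ContinuousWithinAt v (closure Ω) x
  integrable_flux : Integrable (fun x => inner ℝ (v x) (outwardNormal Ω x)) (surfaceMeasure Ω)
  /-- Boundary conditions. -/
  pressure_bc : ∀ᵐ x ∂(surfaceMeasure Ω).restrict Γp, p x = pp x
  velocity_bc : ∀ᵐ x ∂(surfaceMeasure Ω).restrict Γv, inner ℝ (v x) (outwardNormal Ω x) = vn x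

end

end BarusFlow

/-!
Write `F(q) = exp(-β (q / p₀ - 1))` for the reciprocal of the Barus factor (`fluidity`) and consider
the field `W = F(p₂) v₁ - F(p₁) v₂` (`reciprocalFlux`). On `Γv` the data prescribe `v₁ · n` and
`v₂ · n`, on `Γp` they prescribe `p₁` and `p₂`, and the reciprocal relation says precisely that
`∫ W · n dΓ = 0` over `∂Ω`.

`W` is divergence free in `Ω`: since `F' = -(β / p₀) F` and `F(p₂) ∇p₂ = -μ̃₀ K⁻¹ v₂`, the divergence
of `F(p₂) v₁` is `(β / p₀) μ̃₀ v₁ · K⁻¹ v₂`, which is symmetric in the two solutions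
(`integral_inner_reciprocalFlux_gradient`). As `p₂` is only a bounded `H¹` function and `v₁` only a
weakly divergence-free `L²` field, the product rule is proved by mollifying `p₂`
(`integral_comp_mul_inner_gradient`).

It remains to prove the divergence theorem for `W`, which is continuous up to `∂Ω` only off the small
set `S` (`integral_flux_eq_zero`).

* Near a point of `∂Ω \ S` the domain is a subgraph. Testing with a Lipschitz function that rises
  from `0` to `1` between the depths `ε` and `2 ε` below the graph and letting `ε → 0` yields the flux
  through the graph (`setIntegral_inner_gradient_eq_surface`). The limit is identified as a surface
  integral by the area formula for Lipschitz graphs (`euclideanHausdorffMeasure_graphMap_image`), and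
  the normal `(e - ∇φ) / |e - ∇φ|` of the graph is the outward normal wherever `φ` is differentiable,
  hence almost everywhere by Rademacher's theorem.
* A partition of unity gives `∫_Ω W · ∇η = ∫_∂Ω η W · n` for Lipschitz `η` vanishing near `S`
  (`setIntegral_inner_gradient_eq_surface_of_eq_zero`).
* `S` is compact with finite `(d-2)`-dimensional measure, so it is covered by finitely many small
  balls with `∑ rₙ ^ (d - 2)` bounded. The corresponding cutoffs `θ` have bounded Dirichlet integrals
  (`exists_cutoff`), and `∫_Ω W · ∇θ` is small because `W` is square integrable and `∇θ` lives in a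
  small neighbourhood of `S`. With `η = 1 - θ` the limit is `∫_∂Ω W · n = 0`.
-/

/-! ### Mollification -/

namespace BarusFlow

open ContinuousLinearMap Metric
open scoped Convolution ENNReal NNReal

/-- The standard mollifier supported in the closed ball of radius `1 / (k + 1)`. -/
noncomputable def mollifier (d : ℕ) (k : ℕ) : ContDiffBump (0 : Space d) where
  rIn := 1 / (2 * ((k : ℝ) + 1))
  rOut := 1 / ((k : ℝ) + 1)
  rIn_pos := by positivity
  rIn_lt_rOut := by
    apply one_div_lt_one_div_of_lt <;> nlinarith [(Nat.cast_nonneg k : (0 : ℝ) ≤ k)]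

/-- The mollification of `f` at scale `1 / (k + 1)`. -/
noncomputable def mollify {d : ℕ} {F : Type*} [NormedAddCommGroup F] [NormedSpace ℝ F] (k : ℕ)
    (f : Space d → F) : Space d → F :=
  (mollifier d k).normed volume ⋆[lsmul ℝ ℝ, volume] f

variable {d : ℕ} {F : Type*} [NormedAddCommGroup F] [NormedSpace ℝ F]

theorem mollify_apply (k : ℕ) (f : Space d → F) (x : Space d) :
    mollify k f x = ∫ t, (mollifier d k).normed volume t • f (x - t) := rfl

theorem mollify_apply_sub (k : ℕ) (f : Space d → F) (x : Space d) :
    mollify k f x = ∫ y, (mollifier d k).normed volume (x - y) • f y := by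
  rw [mollify_apply, ← integral_sub_left_eq_self _ volume x]
  simp

theorem tendsto_mollifier_rOut (d : ℕ) :
    Tendsto (fun k => (mollifier d k).rOut) atTop (𝓝 0) :=
  tendsto_one_div_add_atTop_nhds_zero_nat

theorem ae_tendsto_mollify [CompleteSpace F] {f : Space d → F} (hf : LocallyIntegrable f) :
    ∀ᵐ x, Tendsto (fun k => mollify k f x) atTop (𝓝 (f x)) := by
  refine ContDiffBump.ae_convolution_tendsto_right_of_locallyIntegrable (K := 2)
    (tendsto_mollifier_rOut d) (Eventually.of_forall fun k => ?_) hf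
  have : (0 : ℝ) < (k : ℝ) + 1 := by positivity
  change 1 / ((k : ℝ) + 1) ≤ 2 * (1 / (2 * ((k : ℝ) + 1)))
  field_simp
  exact le_rfl

theorem contDiff_mollify {f : Space d → ℝ} (hf : LocallyIntegrable f) (k : ℕ) :
    ContDiff ℝ ∞ (mollify k f) :=
  (mollifier d k).hasCompactSupport_normed.contDiff_convolution_left _
    (mollifier d k).contDiff_normed hf

theorem norm_mollify_le {f : Space d → F} {M : ℝ} (hM : ∀ x, ‖f x‖ ≤ M) (k : ℕ)
    (x : Space d) : ‖mollify k f x‖ ≤ M := by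
  have h1 : ∫ t, (mollifier d k).normed volume t * M = M := by
    rw [integral_mul_const, ContDiffBump.integral_normed, one_mul]
  rw [mollify_apply, ← h1]
  refine norm_integral_le_of_norm_le ((mollifier d k).integrable_normed.mul_const M) ?_
  refine Eventually.of_forall fun t => ?_
  rw [norm_smul, Real.norm_of_nonneg ((mollifier d k).nonneg_normed t)]
  exact mul_le_mul_of_nonneg_left (hM _) ((mollifier d k).nonneg_normed t)

theorem mollifier_normed_eq_zero {k : ℕ} {t : Space d} (ht : (mollifier d k).rOut ≤ ‖t‖) :
    (mollifier d k).normed volume t = 0 := by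
  rw [← Function.notMem_support, ContDiffBump.support_normed_eq]
  simpa using ht

/-- If `G` is the weak gradient of `u` as seen by the translated mollifier at `x`, then the
mollification of `u` has at `x` the mollification of `G` as its gradient. -/
theorem hasGradientAt_mollify {u : Space d → ℝ} {G : Space d → Space d}
    (hu : LocallyIntegrable u) (k : ℕ) (x : Space d)
    (h : ∫ y, u y • ∇ (fun z => (mollifier d k).normed volume (x - z)) y
      = - ∫ y, (mollifier d k).normed volume (x - y) • G y) :
    HasGradientAt (mollify k u) (mollify k G x) x := by
  set ρ := (mollifier d k).normed (volume : Measure (Space d)) with hρ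
  have hρc : ContDiff ℝ ∞ ρ := (mollifier d k).contDiff_normed
  have hρs : HasCompactSupport ρ := (mollifier d k).hasCompactSupport_normed
  have hd := hρs.hasFDerivAt_convolution_left (lsmul ℝ ℝ) (hρc.of_le (by simp)) hu x
  rw [hasGradientAt_iff_hasFDerivAt]
  refine hd.congr_fderiv ?_
  symm
  ext w
  rw [InnerProductSpace.toDual_apply_apply]
  have hfd : HasCompactSupport (fderiv ℝ ρ) := hρs.fderiv ℝ
  have hfc : Continuous (fderiv ℝ ρ) := hρc.continuous_fderiv (by simp)
  have hsub : Continuous fun y : Space d => x - y := continuous_const.sub continuous_id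
  have e1 : (fderiv ℝ ρ ⋆[(lsmul ℝ ℝ).precompL (Space d), volume] u) x w
      = ∫ y, u y * fderiv ℝ ρ (x - y) w := by
    rw [convolution_def, ContinuousLinearMap.integral_apply]
    · rw [← integral_sub_left_eq_self _ volume x]
      simp [ContinuousLinearMap.precompL_apply, mul_comm]
    · exact (hfd.convolutionExists_left _ hfc hu) x
  have hgr : ∀ y, ∇ (fun z => ρ (x - z)) y = (InnerProductSpace.toDual ℝ (Space d)).symm
      (-(fderiv ℝ ρ (x - y))) := by
    intro y
    rw [gradient]
    congr 1
    have h' : HasFDerivAt (fun z => ρ (x - z)) (-(fderiv ℝ ρ (x - y))) y :=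
      ((hρc.differentiable (by simp) (x - y)).hasFDerivAt.comp y
        ((hasFDerivAt_id y).const_sub x)).congr_fderiv (by ext; simp)
    exact h'.fderiv
  rw [e1, mollify_apply_sub, ← neg_eq_iff_eq_neg.2 h]
  have hsc : HasCompactSupport fun y => (InnerProductSpace.toDual ℝ (Space d)).symm
      (-(fderiv ℝ ρ (x - y))) := by
    have := (hfd.comp_homeomorph (Homeomorph.subLeft x)).comp_left
      (g := fun L => (InnerProductSpace.toDual ℝ (Space d)).symm (-L)) (by simp)
    exact this
  have hint : Integrable fun y => u y • ∇ (fun z => ρ (x - z)) y := by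
    simp_rw [hgr]
    have hcc : Continuous fun y => (InnerProductSpace.toDual ℝ (Space d)).symm
        (-(fderiv ℝ ρ (x - y))) := by fun_prop
    exact hu.integrable_smul_right_of_hasCompactSupport hcc hsc
  rw [inner_neg_left, ← real_inner_comm, ← integral_inner hint, ← integral_neg]
  congr 1; ext y
  rw [hgr, inner_smul_right, real_inner_comm, InnerProductSpace.toDual_symm_apply]
  simp

/-- Translation is continuous in `L²`. -/
theorem tendsto_eLpNorm_translate_sub {G : Space d → Space d} (hG : MemLp G 2) :
    Tendsto (fun t => eLpNorm (fun x => G (x - t) - G x) 2 volume) (𝓝 0) (𝓝 0) := by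
  have : Fact (1 ≤ (2 : ℝ≥0∞)) := ⟨by norm_num⟩
  let τ : Space d → C(Space d, Space d) := fun t => ⟨fun x => x - t, by fun_prop⟩
  have hτ : Continuous τ :=
    (ContinuousMap.curry ⟨fun p : Space d × Space d => p.2 - p.1, by fun_prop⟩).continuous
  have hmp : ∀ t, MeasurePreserving (τ t) volume volume := fun t =>
    measurePreserving_sub_right volume t
  have := (Continuous.compMeasurePreservingLp (μ := volume) (ν := volume) (p := 2)
    (f := fun _ : Space d => hG.toLp G) continuous_const hτ hmp (by norm_num)).tendsto 0
  rw [tendsto_iff_edist_tendsto_0] at this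
  refine this.congr fun t => ?_
  rw [Lp.edist_def]
  refine eLpNorm_congr_ae ?_
  have a1 := Lp.coeFn_compMeasurePreserving (hG.toLp G) (hmp t)
  have a2 := Lp.coeFn_compMeasurePreserving (hG.toLp G) (hmp 0)
  have a3 := (hmp t).quasiMeasurePreserving.ae_eq_comp hG.coeFn_toLp
  have a4 := (hmp 0).quasiMeasurePreserving.ae_eq_comp hG.coeFn_toLp
  filter_upwards [a1, a2, a3, a4] with x h1 h2 h3 h4
  simp only [Pi.sub_apply]
  rw [h1, h2, h3, h4]
  simp [τ]

theorem lintegral_enorm_mul_enorm_le {α E₁ E₂ : Type*} [MeasurableSpace α]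
    [NormedAddCommGroup E₁] [NormedAddCommGroup E₂] {μ : Measure α} {f : α → E₁} {g : α → E₂}
    (hf : AEStronglyMeasurable f μ) (hg : AEStronglyMeasurable g μ) :
    ∫⁻ x, ‖f x‖ₑ * ‖g x‖ₑ ∂μ ≤ eLpNorm f 2 μ * eLpNorm g 2 μ := by
  have := ENNReal.lintegral_mul_le_Lp_mul_Lq μ Real.HolderConjugate.two_two
    hf.enorm hg.enorm
  rw [eLpNorm_eq_lintegral_rpow_enorm_toReal (by norm_num) (by norm_num),
    eLpNorm_eq_lintegral_rpow_enorm_toReal (by norm_num) (by norm_num)]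
  simpa using this

/-- Mollifications of an `L²` field converge to it when paired with a fixed `L²` field. -/
theorem tendsto_lintegral_enorm_mul_mollify_sub {G v : Space d → Space d} (hG : MemLp G 2)
    (hv : MemLp v 2) :
    Tendsto (fun k => ∫⁻ x, ‖v x‖ₑ * ‖mollify k G x - G x‖ₑ) atTop (𝓝 0) := by
  have hGl : LocallyIntegrable G := hG.locallyIntegrable (by norm_num)
  rw [ENNReal.tendsto_nhds_zero]
  intro ε hε
  obtain ⟨η, hη, hηε⟩ : ∃ η : ℝ≥0∞, 0 < η ∧ eLpNorm v 2 volume * η ≤ ε := by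
    rcases eq_or_ne (eLpNorm v 2 volume) 0 with h0 | h0
    · exact ⟨1, by simp, by simp [h0]⟩
    · exact ⟨ε / eLpNorm v 2 volume, ENNReal.div_pos hε.ne' hv.2.ne, ENNReal.mul_div_le⟩
  have h1 := (ENNReal.tendsto_nhds_zero.1 (tendsto_eLpNorm_translate_sub hG)) η hη
  obtain ⟨r, hr, hball⟩ := Metric.eventually_nhds_iff.1 h1
  have h2 : ∀ᶠ k in atTop, (mollifier d k).rOut < r :=
    (tendsto_mollifier_rOut d).eventually (gt_mem_nhds hr)
  filter_upwards [h2] with k hk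
  set ρ := (mollifier d k).normed (volume : Measure (Space d)) with hρ
  have hρm : Measurable ρ := (mollifier d k).continuous_normed.measurable
  have hρ1 : ∫⁻ t, ‖ρ t‖ₑ = 1 := by
    have := ofReal_integral_norm_eq_lintegral_enorm (μ := volume) (f := ρ)
      (mollifier d k).integrable_normed
    rw [← this]
    simp_rw [hρ, Real.norm_of_nonneg ((mollifier d k).nonneg_normed _)]
    rw [ContDiffBump.integral_normed, ENNReal.ofReal_one]
  have hpt : ∀ x, ‖mollify k G x - G x‖ₑ ≤ ∫⁻ t, ‖ρ t‖ₑ * ‖G (x - t) - G x‖ₑ := by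
    intro x
    have e : mollify k G x - G x = ∫ t, ρ t • (G (x - t) - G x) := by
      simp_rw [smul_sub]
      rw [integral_sub, integral_smul_const, ContDiffBump.integral_normed, one_smul]
      · rfl
      · exact ((mollifier d k).hasCompactSupport_normed.convolutionExists_left (lsmul ℝ ℝ)
          (mollifier d k).continuous_normed hGl) x
      · exact (mollifier d k).integrable_normed.smul_const _
    rw [e]
    refine (enorm_integral_le_lintegral_enorm _).trans (le_of_eq ?_)
    simp_rw [enorm_smul]
  have hsubm : AEStronglyMeasurable (fun p : Space d × Space d => G (p.1 - p.2))
      (volume.prod volume) :=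
    hG.1.comp_quasiMeasurePreserving (quasiMeasurePreserving_sub volume volume)
  have hfst : AEStronglyMeasurable (fun p : Space d × Space d => G p.1) (volume.prod volume) :=
    hG.1.comp_fst
  have hvm : AEStronglyMeasurable (fun p : Space d × Space d => v p.1) (volume.prod volume) :=
    hv.1.comp_fst
  calc ∫⁻ x, ‖v x‖ₑ * ‖mollify k G x - G x‖ₑ
      ≤ ∫⁻ x, ∫⁻ t, ‖v x‖ₑ * (‖ρ t‖ₑ * ‖G (x - t) - G x‖ₑ) := by
        refine lintegral_mono fun x => ?_
        rw [lintegral_const_mul' _ _ (by simp)]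
        gcongr
        exact hpt x
    _ = ∫⁻ t, ∫⁻ x, ‖v x‖ₑ * (‖ρ t‖ₑ * ‖G (x - t) - G x‖ₑ) := by
        refine lintegral_lintegral_swap ?_
        exact hvm.enorm.mul ((hρm.comp measurable_snd).enorm.aemeasurable.mul
          (hsubm.sub hfst).enorm)
    _ = ∫⁻ t, ‖ρ t‖ₑ * ∫⁻ x, ‖v x‖ₑ * ‖G (x - t) - G x‖ₑ := by
        refine lintegral_congr fun t => ?_
        rw [← lintegral_const_mul' _ _ (by simp)]
        refine lintegral_congr fun x => ?_
        ring
    _ ≤ ∫⁻ t, ‖ρ t‖ₑ * ε := by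
        refine lintegral_mono fun t => ?_
        by_cases ht : ‖t‖ < (mollifier d k).rOut
        · gcongr
          refine (lintegral_enorm_mul_enorm_le hv.1 ?_).trans (le_trans ?_ hηε)
          · exact (hG.1.comp_measurePreserving (measurePreserving_sub_right volume t)).sub hG.1
          · gcongr
            exact hball (by simpa using ht.trans hk)
        · simp [hρ, mollifier_normed_eq_zero (not_lt.1 ht)]
    _ = ε := by
        rw [lintegral_mul_const _ hρm.enorm, hρ1, one_mul]

end BarusFlow

/-! ### Weak gradients and weak divergence -/

namespace BarusFlow

open ContinuousLinearMap Metric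
open scoped Convolution ENNReal NNReal

variable {d : ℕ}

theorem inner_gradient_eq_fderiv (φ : Space d → ℝ) (x w : Space d) :
    inner ℝ w (∇ φ x) = fderiv ℝ φ x w := by
  simp

theorem norm_gradient (φ : Space d → ℝ) (x : Space d) : ‖∇ φ x‖ = ‖fderiv ℝ φ x‖ := by
  simp [gradient]

theorem gradient_eq_zero_of_notMem_tsupport {φ : Space d → ℝ} {x : Space d}
    (hx : x ∉ tsupport φ) : ∇ φ x = 0 := by
  have h : φ =ᶠ[𝓝 x] fun _ => 0 := notMem_tsupport_iff_eventuallyEq.1 hx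
  rw [h.gradient_eq, gradient_fun_const]

theorem continuous_gradient {φ : Space d → ℝ} (h : ContDiff ℝ ∞ φ) : Continuous (∇ φ) :=
  (InnerProductSpace.toDual ℝ (Space d)).symm.continuous.comp (h.continuous_fderiv (by simp))

theorem hasCompactSupport_gradient {φ : Space d → ℝ} (h : HasCompactSupport φ) :
    HasCompactSupport (∇ φ) :=
  (h.fderiv ℝ).comp_left (g := (InnerProductSpace.toDual ℝ (Space d)).symm) (map_zero _)

theorem isTestFunction_mollifier {Ω : Set (Space d)} {k : ℕ} {x : Space d}
    (h : closedBall x (mollifier d k).rOut ⊆ Ω) :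
    IsTestFunction Ω fun y => (mollifier d k).normed volume (x - y) where
  smooth := (mollifier d k).contDiff_normed.comp (contDiff_const.sub contDiff_id)
  hasCompactSupport := (mollifier d k).hasCompactSupport_normed.comp_homeomorph
    (Homeomorph.subLeft x)
  tsupport_subset := by
    refine (closure_minimal (fun y hy => ?_) isClosed_closedBall).trans h
    rw [mem_closedBall, dist_comm, dist_eq_norm]
    by_contra hlt
    exact hy (mollifier_normed_eq_zero (not_le.1 hlt).le)

/-- Around a compact subset of an open set, all sufficiently fine mollifiers are admissible. -/
theorem eventually_closedBall_mollifier_subset {Ω K : Set (Space d)} (hΩ : IsOpen Ω)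
    (hK : IsCompact K) (hKΩ : K ⊆ Ω) :
    ∀ᶠ k in atTop, ∀ x ∈ K, closedBall x (mollifier d k).rOut ⊆ Ω := by
  obtain ⟨δ, hδ, hsub⟩ := hK.exists_cthickening_subset_open hΩ hKΩ
  filter_upwards [(tendsto_mollifier_rOut d).eventually (gt_mem_nhds hδ)] with k hk x hx
  refine subset_trans ?_ hsub
  exact (closedBall_subset_closedBall hk.le).trans (closedBall_subset_cthickening hx δ)

/-- Product and chain rule: if `v` is divergence free and `u` is bounded with weak gradient `G`,
then `F(u) v` has divergence `F'(u) v · G`.  The mollifications `uₖ` of `u` make `F(uₖ) φ` a test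
function for `v`; the passage to the limit uses only the `L²` convergence of the gradients. -/
theorem integral_comp_mul_inner_gradient {Ω : Set (Space d)} (hΩ : IsOpen Ω)
    {u : Space d → ℝ} {G v : Space d → Space d} {M : ℝ} (hM : ∀ x, |u x| ≤ M)
    (hu : AEStronglyMeasurable u volume) (hG : MemLp G 2) (hv : MemLp v 2)
    (huG : ∀ φ, IsTestFunction Ω φ → ∫ x, u x • ∇ φ x = - ∫ x, φ x • G x)
    (hdiv : ∀ φ, IsTestFunction Ω φ → ∫ x, inner ℝ (v x) (∇ φ x) = 0)
    {f : ℝ → ℝ} (hf : ContDiff ℝ ∞ f) {φ : Space d → ℝ} (hφ : IsTestFunction Ω φ) :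
    ∫ x, f (u x) * inner ℝ (v x) (∇ φ x)
      = - ∫ x, φ x * (deriv f (u x) * inner ℝ (v x) (G x)) := by
  have hul : LocallyIntegrable u := by
    have : MemLp u ∞ := memLp_top_of_bound hu M (Eventually.of_forall hM)
    exact this.locallyIntegrable (by simp)
  have hGl : LocallyIntegrable G := hG.locallyIntegrable (by norm_num)
  have hfc : Continuous f := hf.continuous
  have hf'c : Continuous (deriv f) := hf.continuous_deriv (by simp)
  obtain ⟨C, hC⟩ := (isCompact_Icc (a := -M) (b := M)).exists_bound_of_continuousOn
    hfc.continuousOn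
  obtain ⟨C', hC'⟩ := (isCompact_Icc (a := -M) (b := M)).exists_bound_of_continuousOn
    hf'c.continuousOn
  have hMk : ∀ k x, mollify k u x ∈ Icc (-M) M := fun k x =>
    abs_le.1 (norm_mollify_le (f := u) hM k x)
  have hlim := ae_tendsto_mollify hul
  have hum : ∀ k, Continuous (mollify k u) := fun k => (contDiff_mollify hul k).continuous
  have hφc : Continuous φ := hφ.smooth.continuous
  have hgc := continuous_gradient hφ.smooth
  obtain ⟨B, hB⟩ := hφc.bounded_above_of_compact_support hφ.hasCompactSupport
  have hvg : Integrable fun x => ‖v x‖ * ‖∇ φ x‖ := by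
    have := (hv.norm.locallyIntegrable (by norm_num)).integrable_smul_right_of_hasCompactSupport
      hgc.norm (hasCompactSupport_gradient hφ.hasCompactSupport).norm
    simpa using this
  have hvG : Integrable fun x => ‖v x‖ * ‖G x‖ := hv.norm.integrable_mul hG.norm
  -- The passage to the limit in each of the three terms of the product rule.
  have T1 : Tendsto (fun k => ∫ x, f (mollify k u x) * inner ℝ (v x) (∇ φ x)) atTop
      (𝓝 (∫ x, f (u x) * inner ℝ (v x) (∇ φ x))) := by
    refine tendsto_integral_of_dominated_convergence (fun x => C * (‖v x‖ * ‖∇ φ x‖))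
      (fun k => ?_) (hvg.const_mul C) (fun k => Eventually.of_forall fun x => ?_) ?_
    · exact (hfc.comp (hum k)).aestronglyMeasurable.mul
        (hv.1.inner hgc.aestronglyMeasurable)
    · rw [norm_mul]
      exact mul_le_mul (hC _ (hMk k x)) (norm_inner_le_norm _ _) (norm_nonneg _)
        ((norm_nonneg _).trans (hC _ (hMk k x)))
    · filter_upwards [hlim] with x hx
      exact ((hfc.tendsto _).comp hx).mul_const _
  have T2 : Tendsto (fun k => ∫ x, φ x * (deriv f (mollify k u x) * inner ℝ (v x) (G x))) atTop
      (𝓝 (∫ x, φ x * (deriv f (u x) * inner ℝ (v x) (G x)))) := by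
    refine tendsto_integral_of_dominated_convergence (fun x => B * (C' * (‖v x‖ * ‖G x‖)))
      (fun k => ?_) ((hvG.const_mul C').const_mul B) (fun k => Eventually.of_forall fun x => ?_) ?_
    · exact hφc.aestronglyMeasurable.mul ((hf'c.comp (hum k)).aestronglyMeasurable.mul
        (hv.1.inner hG.1))
    · rw [norm_mul, norm_mul]
      have h0 := (norm_nonneg _).trans (hC' _ (hMk k x))
      exact mul_le_mul (hB x) (mul_le_mul (hC' _ (hMk k x)) (norm_inner_le_norm _ _)
        (norm_nonneg _) h0) (by positivity) ((norm_nonneg _).trans (hB x))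
    · filter_upwards [hlim] with x hx
      exact (((hf'c.tendsto _).comp hx).mul_const _).const_mul _
  have hmG : ∀ k, Continuous (mollify k G) := fun k =>
    (mollifier d k).hasCompactSupport_normed.continuous_convolution_left _
      (mollifier d k).continuous_normed hGl
  have hmeas3 : ∀ k, AEStronglyMeasurable (fun x => φ x * (deriv f (mollify k u x) *
      inner ℝ (v x) (mollify k G x - G x))) volume := fun k =>
    hφc.aestronglyMeasurable.mul ((hf'c.comp (hum k)).aestronglyMeasurable.mul
        (hv.1.inner ((hmG k).aestronglyMeasurable.sub hG.1)))
  have hbd3 : ∀ k, ∫⁻ x, ‖φ x * (deriv f (mollify k u x) *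
      inner ℝ (v x) (mollify k G x - G x))‖ₑ ≤
      ENNReal.ofReal (B * C') * ∫⁻ x, ‖v x‖ₑ * ‖mollify k G x - G x‖ₑ := by
    intro k
    rw [← lintegral_const_mul' _ _ ENNReal.ofReal_ne_top]
    refine lintegral_mono fun x => ?_
    have h0 := (norm_nonneg _).trans (hC' _ (hMk k x))
    have hB0 := (norm_nonneg _).trans (hB x)
    rw [← ofReal_norm, ← ofReal_norm (v x), ← ofReal_norm,
      ← ENNReal.ofReal_mul (norm_nonneg _), ← ENNReal.ofReal_mul (by positivity)]
    refine ENNReal.ofReal_le_ofReal ?_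
    rw [norm_mul, norm_mul, mul_assoc B]
    exact mul_le_mul (hB x) (mul_le_mul (hC' _ (hMk k x)) (norm_inner_le_norm _ _)
        (norm_nonneg _) h0) (by positivity) hB0
  have hlim3 : Tendsto (fun k => ENNReal.ofReal (B * C') *
      ∫⁻ x, ‖v x‖ₑ * ‖mollify k G x - G x‖ₑ) atTop (𝓝 0) := by
    have := ENNReal.Tendsto.const_mul (a := ENNReal.ofReal (B * C'))
      (tendsto_lintegral_enorm_mul_mollify_sub hG hv) (Or.inr ENNReal.ofReal_ne_top)
    simpa using this
  have T3l : Tendsto (fun k => ∫⁻ x, ‖φ x * (deriv f (mollify k u x) *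
      inner ℝ (v x) (mollify k G x - G x))‖ₑ) atTop (𝓝 0) :=
    tendsto_of_tendsto_of_tendsto_of_le_of_le tendsto_const_nhds hlim3 (fun _ => zero_le) hbd3
  have T3 : Tendsto (fun k => ∫ x, φ x * (deriv f (mollify k u x) *
      inner ℝ (v x) (mollify k G x - G x))) atTop (𝓝 0) := by
    rw [tendsto_zero_iff_enorm_tendsto_zero]
    exact tendsto_of_tendsto_of_tendsto_of_le_of_le tendsto_const_nhds T3l (fun _ => zero_le)
      fun k => enorm_integral_le_lintegral_enorm _
  have key : ∀ᶠ k in atTop, ∫ x, f (mollify k u x) * inner ℝ (v x) (∇ φ x) =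
      -((∫ x, φ x * (deriv f (mollify k u x) * inner ℝ (v x) (G x)))
        + ∫ x, φ x * (deriv f (mollify k u x) * inner ℝ (v x) (mollify k G x - G x))) := by
    have hfin : ∀ᶠ k in atTop, ENNReal.ofReal (B * C') *
        ∫⁻ x, ‖v x‖ₑ * ‖mollify k G x - G x‖ₑ < ⊤ :=
      hlim3.eventually (gt_mem_nhds (by simp))
    filter_upwards [eventually_closedBall_mollifier_subset hΩ hφ.hasCompactSupport
      hφ.tsupport_subset, hfin] with k hk hkfin
    have hI1 : Integrable fun x => f (mollify k u x) * inner ℝ (v x) (∇ φ x) := by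
      refine (hvg.const_mul C).mono' ((hfc.comp (hum k)).aestronglyMeasurable.mul
        (hv.1.inner hgc.aestronglyMeasurable)) (Eventually.of_forall fun x => ?_)
      rw [norm_mul]
      exact mul_le_mul (hC _ (hMk k x)) (norm_inner_le_norm _ _) (norm_nonneg _)
        ((norm_nonneg _).trans (hC _ (hMk k x)))
    have hI2 : Integrable fun x => φ x * (deriv f (mollify k u x) * inner ℝ (v x) (G x)) := by
      refine ((hvG.const_mul C').const_mul B).mono'
        (hφc.aestronglyMeasurable.mul ((hf'c.comp (hum k)).aestronglyMeasurable.mul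
        (hv.1.inner hG.1))) (Eventually.of_forall fun x => ?_)
      rw [norm_mul, norm_mul]
      have h0 := (norm_nonneg _).trans (hC' _ (hMk k x))
      exact mul_le_mul (hB x) (mul_le_mul (hC' _ (hMk k x)) (norm_inner_le_norm _ _)
        (norm_nonneg _) h0) (by positivity) ((norm_nonneg _).trans (hB x))
    have hI3 : Integrable fun x => φ x * (deriv f (mollify k u x) *
        inner ℝ (v x) (mollify k G x - G x)) :=
      ⟨hmeas3 k, (hbd3 k).trans_lt hkfin⟩
    have htest : IsTestFunction Ω fun x => f (mollify k u x) * φ x :=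
      { smooth := (hf.comp (contDiff_mollify hul k)).mul hφ.smooth
        hasCompactSupport := hφ.hasCompactSupport.mul_left
        tsupport_subset := (tsupport_mul_subset_right).trans hφ.tsupport_subset }
    have h0 := hdiv _ htest
    have hgrad : ∀ x, inner ℝ (v x) (∇ (fun x => f (mollify k u x) * φ x) x)
        = f (mollify k u x) * inner ℝ (v x) (∇ φ x)
          + (φ x * (deriv f (mollify k u x) * inner ℝ (v x) (G x))
          + φ x * (deriv f (mollify k u x) * inner ℝ (v x) (mollify k G x - G x))) := by
      intro x
      by_cases hx : x ∈ tsupport φ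
      · have hm := (hasGradientAt_mollify hul k x
          (huG _ (isTestFunction_mollifier (hk x hx)))).hasFDerivAt
        have hfd := (hf.differentiable (by simp) (mollify k u x)).hasDerivAt.comp_hasFDerivAt x hm
        have hφd := (hφ.smooth.differentiable (by simp) x).hasFDerivAt
        have := (hfd.mul hφd).fderiv
        rw [inner_gradient_eq_fderiv, inner_gradient_eq_fderiv]
        have h2 := congrArg (fun L => L (v x)) this
        simp only [add_apply, smul_apply,
          InnerProductSpace.toDual_apply_apply, smul_eq_mul] at h2
        refine Eq.trans h2 ?_
        rw [inner_sub_right, real_inner_comm (v x)]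
        simp only [Function.comp_apply]
        ring
      · rw [gradient_eq_zero_of_notMem_tsupport hx, gradient_eq_zero_of_notMem_tsupport
          (fun h => hx (tsupport_mul_subset_right h)), image_eq_zero_of_notMem_tsupport hx]
        simp
    simp_rw [hgrad] at h0
    have hI23 : Integrable fun x => φ x * (deriv f (mollify k u x) * inner ℝ (v x) (G x))
        + φ x * (deriv f (mollify k u x) * inner ℝ (v x) (mollify k G x - G x)) := hI2.add hI3
    rw [integral_add hI1 hI23, integral_add hI2 hI3] at h0
    linarith
  have hR := (T2.add T3).neg
  rw [add_zero] at hR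
  exact tendsto_nhds_unique T1 (hR.congr' (key.mono fun k hk => hk.symm))

theorem measurable_gradient (ψ : Space d → ℝ) : Measurable (∇ ψ) :=
  (InnerProductSpace.toDual ℝ (Space d)).symm.continuous.measurable.comp (measurable_fderiv ℝ ψ)

theorem norm_gradient_le_of_lipschitzWith {ψ : Space d → ℝ} {C : ℝ≥0} (hψ : LipschitzWith C ψ)
    (x : Space d) : ‖∇ ψ x‖ ≤ C := by
  rw [norm_gradient]
  exact norm_fderiv_le_of_lipschitz ℝ hψ

theorem locallyIntegrable_gradient_of_lipschitzWith {ψ : Space d → ℝ} {C : ℝ≥0}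
    (hψ : LipschitzWith C ψ) : LocallyIntegrable (∇ ψ) := by
  have : MemLp (∇ ψ) ∞ := memLp_top_of_bound (measurable_gradient ψ).aestronglyMeasurable C
    (Eventually.of_forall (norm_gradient_le_of_lipschitzWith hψ))
  exact this.locallyIntegrable (by simp)

/-- The almost everywhere gradient of a Lipschitz function is its weak gradient. -/
theorem integral_smul_gradient_of_lipschitz {ψ g : Space d → ℝ} {C : ℝ≥0}
    (hψ : LipschitzWith C ψ) (hg : ContDiff ℝ ∞ g) (hgs : HasCompactSupport g) :
    ∫ y, ψ y • ∇ g y = - ∫ y, g y • ∇ ψ y := by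
  obtain ⟨D, hD⟩ := hg.lipschitzWith_of_hasCompactSupport hgs (by simp)
  have hi1 : Integrable fun y => ψ y • ∇ g y :=
    hψ.continuous.locallyIntegrable.integrable_smul_right_of_hasCompactSupport
      (continuous_gradient hg) (hasCompactSupport_gradient hgs)
  have hi2 : Integrable fun y => g y • ∇ ψ y :=
    (locallyIntegrable_gradient_of_lipschitzWith hψ).integrable_smul_left_of_hasCompactSupport
      hg.continuous hgs
  refine ext_inner_left ℝ fun w => ?_
  rw [inner_neg_right, ← integral_inner hi1, ← integral_inner hi2]
  have h := LipschitzWith.integral_lineDeriv_mul_eq (μ := volume) hψ hD hgs w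
  have e1 : ∫ y, inner ℝ w (g y • ∇ ψ y) = ∫ y, lineDeriv ℝ ψ y w * g y := by
    refine integral_congr_ae ?_
    filter_upwards [hψ.ae_differentiableAt (μ := volume)] with y hy
    rw [inner_smul_right, inner_gradient_eq_fderiv, hy.lineDeriv_eq_fderiv, mul_comm]
  have e2 : ∫ y, inner ℝ w (ψ y • ∇ g y) = - ∫ y, lineDeriv ℝ g y (-w) * ψ y := by
    rw [← integral_neg]
    refine integral_congr_ae (Eventually.of_forall fun y => ?_)
    simp only []
    rw [inner_smul_right, inner_gradient_eq_fderiv,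
      (hg.differentiable (by simp) y).lineDeriv_eq_fderiv, map_neg]
    ring
  rw [e1, e2, h]

theorem mollify_eq_zero_of_notMem_cthickening {F : Type*} [NormedAddCommGroup F] [NormedSpace ℝ F]
    {f : Space d → F} {K : Set (Space d)} (hf : ∀ x, x ∉ K → f x = 0) {k : ℕ} {δ : ℝ}
    (hδ : (mollifier d k).rOut ≤ δ) {x : Space d} (hx : x ∉ cthickening δ K) :
    mollify k f x = 0 := by
  rw [mollify_apply]
  refine integral_eq_zero_of_ae (Eventually.of_forall fun t => ?_)
  by_cases ht : (mollifier d k).rOut ≤ ‖t‖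
  · simp [mollifier_normed_eq_zero ht]
  · have : x - t ∉ K := fun h => hx (mem_cthickening_of_dist_le x (x - t) δ K h (by
      simpa using (not_le.1 ht).le.trans hδ))
    simp [hf _ this]

/-- A field that is divergence free against smooth test functions is so against Lipschitz functions
with compact support in `Ω`. -/
theorem integral_inner_gradient_eq_zero_of_lipschitz {Ω : Set (Space d)} (hΩ : IsOpen Ω)
    {w : Space d → Space d} (hw : LocallyIntegrable w)
    (hdiv : ∀ φ, IsTestFunction Ω φ → ∫ x, inner ℝ (w x) (∇ φ x) = 0)
    {ψ : Space d → ℝ} {C : ℝ≥0} (hψ : LipschitzWith C ψ) (hψs : HasCompactSupport ψ)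
    (hψΩ : tsupport ψ ⊆ Ω) : ∫ x, inner ℝ (w x) (∇ ψ x) = 0 := by
  obtain ⟨δ, hδ, hsub⟩ := hψs.isCompact.exists_cthickening_subset_open hΩ hψΩ
  have hgl := locallyIntegrable_gradient_of_lipschitzWith hψ
  have hgrad : ∀ k x, ∇ (mollify k ψ) x = mollify k (∇ ψ) x := fun k x =>
    (hasGradientAt_mollify hψ.continuous.locallyIntegrable k x
      (integral_smul_gradient_of_lipschitz hψ
        (isTestFunction_mollifier (subset_univ _)).smooth
        (isTestFunction_mollifier (subset_univ _)).hasCompactSupport)).gradient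
  have hK : IsCompact (cthickening δ (tsupport ψ)) := hψs.isCompact.cthickening
  have hev : ∀ᶠ k in atTop, (mollifier d k).rOut ≤ δ :=
    ((tendsto_mollifier_rOut d).eventually (gt_mem_nhds hδ)).mono fun _ h => h.le
  have hzero : ∀ᶠ k in atTop, ∫ x, inner ℝ (w x) (mollify k (∇ ψ) x) = 0 := by
    filter_upwards [hev] with k hk
    simp_rw [← hgrad]
    have hts : tsupport (mollify k ψ) ⊆ cthickening δ (tsupport ψ) := by
      refine closure_minimal (fun x hx => ?_) isClosed_cthickening
      by_contra h
      exact hx (mollify_eq_zero_of_notMem_cthickening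
        (fun _ h => image_eq_zero_of_notMem_tsupport h) hk h)
    exact hdiv _
      { smooth := contDiff_mollify hψ.continuous.locallyIntegrable k
        hasCompactSupport := hK.of_isClosed_subset (isClosed_tsupport _) hts
        tsupport_subset := hts.trans hsub }
  have hlim : Tendsto (fun k => ∫ x, inner ℝ (w x) (mollify k (∇ ψ) x)) atTop
      (𝓝 (∫ x, inner ℝ (w x) (∇ ψ x))) := by
    refine tendsto_integral_filter_of_dominated_convergence
      (fun x => (cthickening δ (tsupport ψ)).indicator (fun x => ‖w x‖ * C) x)
      (Eventually.of_forall fun k => ?_) ?_ ?_ ?_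
    · refine hw.aestronglyMeasurable.inner ?_
      exact ((mollifier d k).hasCompactSupport_normed.continuous_convolution_left _
        (mollifier d k).continuous_normed hgl).aestronglyMeasurable
    · filter_upwards [hev] with k hk
      refine Eventually.of_forall fun x => ?_
      by_cases hx : x ∈ cthickening δ (tsupport ψ)
      · rw [indicator_of_mem hx]
        exact (norm_inner_le_norm _ _).trans (mul_le_mul_of_nonneg_left
          (norm_mollify_le (norm_gradient_le_of_lipschitzWith hψ) k x) (norm_nonneg _))
      · rw [indicator_of_notMem hx, mollify_eq_zero_of_notMem_cthickening
          (fun _ h => gradient_eq_zero_of_notMem_tsupport h) hk hx]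
        simp
    · rw [integrable_indicator_iff hK.measurableSet]
      exact ((hw.integrableOn_isCompact hK).norm).mul_const _
    · filter_upwards [ae_tendsto_mollify hgl] with x hx
      exact tendsto_const_nhds.inner hx
  exact tendsto_nhds_unique hlim (tendsto_const_nhds.congr' (hzero.mono fun k hk => hk.symm))

end BarusFlow

/-! ### The reciprocal flux -/

namespace BarusFlow

variable {d : ℕ}

/-- Product and chain rule inside `Ω`. -/
theorem setIntegral_comp_mul_inner_gradient {Ω : Set (Space d)} (hΩ : IsOpen Ω)
    {u : Space d → ℝ} {G v : Space d → Space d} {M : ℝ} (hM : ∀ x ∈ Ω, |u x| ≤ M)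
    (hu : AEStronglyMeasurable u (volume.restrict Ω)) (hG : MemLp G 2 (volume.restrict Ω))
    (hv : MemLp v 2 (volume.restrict Ω)) (huG : IsWeakGradient Ω u G)
    (hdiv : IsWeaklyDivergenceFree Ω v)
    {f : ℝ → ℝ} (hf : ContDiff ℝ ∞ f) {φ : Space d → ℝ} (hφ : IsTestFunction Ω φ) :
    ∫ x in Ω, f (u x) * inner ℝ (v x) (∇ φ x)
      = - ∫ x in Ω, φ x * (deriv f (u x) * inner ℝ (v x) (G x)) := by
  have hm := hΩ.measurableSet
  have hM' : ∀ x, |Ω.indicator u x| ≤ |M| := fun x => by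
    by_cases hx : x ∈ Ω
    · simpa [hx] using (hM x hx).trans (le_abs_self M)
    · simp [hx]
  have key := integral_comp_mul_inner_gradient hΩ hM'
    ((aestronglyMeasurable_indicator_iff hm).2 hu) ((memLp_indicator_iff_restrict hm).2 hG)
    ((memLp_indicator_iff_restrict hm).2 hv) (fun φ hφ => ?_) (fun φ hφ => ?_) hf hφ
  · rw [← integral_indicator hm, ← integral_indicator hm]
    refine (integral_congr_ae (.of_forall fun x => ?_)).trans
      (key.trans (congrArg Neg.neg (integral_congr_ae (.of_forall fun x => ?_))))
    all_goals by_cases hx : x ∈ Ω <;> simp [hx]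
  · have := huG.2.2 φ hφ
    rw [← integral_indicator hm, ← integral_indicator hm] at this
    refine (integral_congr_ae (.of_forall fun x => ?_)).trans
      (this.trans (congrArg Neg.neg (integral_congr_ae (.of_forall fun x => ?_))))
    all_goals by_cases hx : x ∈ Ω <;> simp [hx]
  · have := hdiv.2 φ hφ
    rw [← integral_indicator hm] at this
    refine (integral_congr_ae (.of_forall fun x => ?_)).trans this
    by_cases hx : x ∈ Ω <;> simp [hx]

theorem integrable_inner_of_memLp_two {μ : Measure (Space d)} {f g : Space d → Space d}
    (hf : MemLp f 2 μ) (hg : MemLp g 2 μ) : Integrable (fun x => inner ℝ (f x) (g x)) μ :=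
  (hf.norm.integrable_mul hg.norm).mono' (hf.1.inner hg.1)
    (Eventually.of_forall fun _ => norm_inner_le_norm _ _)

/-- The reciprocal of the Barus factor. -/
noncomputable def fluidity (β p₀ q : ℝ) : ℝ := Real.exp (-(β * (q / p₀ - 1)))

theorem contDiff_fluidity (β p₀ : ℝ) : ContDiff ℝ ∞ (fluidity β p₀) := by
  unfold fluidity; fun_prop

theorem deriv_fluidity (β p₀ q : ℝ) :
    deriv (fluidity β p₀) q = -(β / p₀) * fluidity β p₀ q := by
  have h : HasDerivAt (fluidity β p₀)
      (Real.exp (-(β * (q / p₀ - 1))) * -(β * (1 / p₀))) q :=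
    (((((hasDerivAt_id q).div_const p₀).sub_const 1).const_mul β).neg).exp
  rw [h.deriv, fluidity]; ring

theorem fluidity_mul_barusFactor (β p₀ q : ℝ) : fluidity β p₀ q * barusFactor β p₀ q = 1 := by
  rw [fluidity, barusFactor, ← Real.exp_add]; simp

/-- The combination `g(p₂)⁻¹ v₁ - g(p₁)⁻¹ v₂` of two flows. -/
noncomputable def reciprocalFlux (β p₀ : ℝ) (p₁ p₂ : Space d → ℝ) (v₁ v₂ : Space d → Space d)
    (x : Space d) : Space d :=
  fluidity β p₀ (p₂ x) • v₁ x - fluidity β p₀ (p₁ x) • v₂ x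

theorem exists_fluidity_bound (β p₀ M : ℝ) :
    ∃ C, ∀ q, |q| ≤ M → ‖fluidity β p₀ q‖ ≤ C := by
  obtain ⟨C, hC⟩ := (isCompact_Icc (a := -M) (b := M)).exists_bound_of_continuousOn
    (contDiff_fluidity β p₀).continuous.continuousOn
  exact ⟨C, fun q hq => hC _ (abs_le.1 hq)⟩

theorem memLp_fluidity_smul {μ : Measure (Space d)} (β p₀ : ℝ) {p : Space d → ℝ} {M : ℝ}
    (hM : ∀ᵐ x ∂μ, |p x| ≤ M) (hp : AEStronglyMeasurable p μ) {v : Space d → Space d}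
    (hv : MemLp v 2 μ) : MemLp (fun x => fluidity β p₀ (p x) • v x) 2 μ := by
  obtain ⟨C, hC⟩ := exists_fluidity_bound β p₀ M
  refine hv.of_le_mul (c := C)
    (((contDiff_fluidity β p₀).continuous.comp_aestronglyMeasurable hp).smul hv.1) ?_
  filter_upwards [hM] with x hx
  rw [norm_smul]
  exact mul_le_mul_of_nonneg_right (hC _ hx) (norm_nonneg _)

theorem inner_toEuclideanLin_comm {A : Matrix (Fin d) (Fin d) ℝ} (hA : A.IsSymm) (x y : Space d) :
    inner ℝ x (Matrix.toEuclideanLin A y) = inner ℝ y (Matrix.toEuclideanLin A x) := by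
  have h : A.conjTranspose = A := by
    rw [Matrix.conjTranspose_eq_transpose_of_trivial]; exact hA
  have := LinearMap.adjoint_inner_left (Matrix.toEuclideanLin A) x y
  rw [← Matrix.toEuclideanLin_conjTranspose_eq_adjoint, h] at this
  rw [← this, real_inner_comm]

variable {Ω : Set (Space d)} {μ₀ β p₀ : ℝ} {ξ : Space d → ℝ}
  {K : Space d → Matrix (Fin d) (Fin d) ℝ} {Γp Γv : Set (Space d)}
  {pp₁ pp₂ vn₁ vn₂ p₁ p₂ : Space d → ℝ} {v₁ v₂ : Space d → Space d}

theorem memLp_reciprocalFlux (hΩ : IsOpen Ω)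
    (h₁ : IsBarusSolution Ω μ₀ β p₀ ξ K Γp Γv pp₁ vn₁ p₁ v₁)
    (h₂ : IsBarusSolution Ω μ₀ β p₀ ξ K Γp Γv pp₂ vn₂ p₂ v₂) :
    MemLp (reciprocalFlux β p₀ p₁ p₂ v₁ v₂) 2 (volume.restrict Ω) := by
  obtain ⟨M₁, hM₁⟩ := h₁.bounded_p
  obtain ⟨M₂, hM₂⟩ := h₂.bounded_p
  exact (memLp_fluidity_smul β p₀ (ae_restrict_of_forall_mem hΩ.measurableSet hM₂)
    h₂.memLp_p.1 h₁.memLp_v).sub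
    (memLp_fluidity_smul β p₀ (ae_restrict_of_forall_mem hΩ.measurableSet hM₁) h₁.memLp_p.1 h₂.memLp_v)

/-- The reciprocal flux is divergence free: by the momentum balance the divergence of
`g(p₂)⁻¹ v₁` is `(β / p₀) μ̃₀ v₁ · K⁻¹ v₂`, which is symmetric in the two flows. -/
theorem integral_inner_reciprocalFlux_gradient (hΩ : IsOpen Ω) (hK : ∀ x ∈ Ω, (K x).IsSymm)
    (h₁ : IsBarusSolution Ω μ₀ β p₀ ξ K Γp Γv pp₁ vn₁ p₁ v₁)
    (h₂ : IsBarusSolution Ω μ₀ β p₀ ξ K Γp Γv pp₂ vn₂ p₂ v₂)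
    {φ : Space d → ℝ} (hφ : IsTestFunction Ω φ) :
    ∫ x in Ω, inner ℝ (reciprocalFlux β p₀ p₁ p₂ v₁ v₂ x) (∇ φ x) = 0 := by
  obtain ⟨M₁, hM₁⟩ := h₁.bounded_p
  obtain ⟨M₂, hM₂⟩ := h₂.bounded_p
  obtain ⟨G₁, hG₁, hw₁, hm₁⟩ := h₁.momentum
  obtain ⟨G₂, hG₂, hw₂, hm₂⟩ := h₂.momentum
  have e₁ := setIntegral_comp_mul_inner_gradient hΩ hM₂ h₂.memLp_p.1 hG₂ h₁.memLp_v
    hw₂ h₁.mass (contDiff_fluidity β p₀) hφ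
  have e₂ := setIntegral_comp_mul_inner_gradient hΩ hM₁ h₁.memLp_p.1 hG₁ h₂.memLp_v
    hw₁ h₂.mass (contDiff_fluidity β p₀) hφ
  have hgrad : MemLp (∇ φ) 2 (volume.restrict Ω) :=
    ((continuous_gradient hφ.smooth).memLp_of_hasCompactSupport
      (hasCompactSupport_gradient hφ.hasCompactSupport)).restrict Ω
  have hI : ∀ {p : Space d → ℝ} {v : Space d → Space d} {M : ℝ}, (∀ x ∈ Ω, |p x| ≤ M) →
      MemLp p 2 (volume.restrict Ω) → MemLp v 2 (volume.restrict Ω) →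
      IntegrableOn (fun x => fluidity β p₀ (p x) * inner ℝ (v x) (∇ φ x)) Ω := by
    intro p v M hM hp hv
    have h := integrable_inner_of_memLp_two (memLp_fluidity_smul β p₀
      (ae_restrict_of_forall_mem hΩ.measurableSet hM) hp.1 hv) hgrad
    simpa only [IntegrableOn, real_inner_smul_left] using h
  have hsym : ∫ x in Ω, φ x * (deriv (fluidity β p₀) (p₂ x) * inner ℝ (v₁ x) (G₂ x))
      = ∫ x in Ω, φ x * (deriv (fluidity β p₀) (p₁ x) * inner ℝ (v₂ x) (G₁ x)) := by
    refine integral_congr_ae ?_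
    filter_upwards [hm₁, hm₂, ae_restrict_mem hΩ.measurableSet] with x hx₁ hx₂ hx
    have hs : (K x)⁻¹.IsSymm := by
      rw [Matrix.IsSymm, Matrix.transpose_nonsing_inv, hK x hx]
    rw [eq_neg_of_add_eq_zero_right hx₁, eq_neg_of_add_eq_zero_right hx₂, inner_neg_right,
      inner_neg_right, inner_smul_right, inner_smul_right, inner_toEuclideanLin_comm hs (v₂ x),
      deriv_fluidity, deriv_fluidity]
    have f₁ := fluidity_mul_barusFactor β p₀ (p₁ x)
    have f₂ := fluidity_mul_barusFactor β p₀ (p₂ x)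
    linear_combination (φ x * (β / p₀) * viscosityCoeff μ₀ β p₀ ξ x *
      inner ℝ (v₁ x) (Matrix.toEuclideanLin (K x)⁻¹ (v₂ x))) * (f₂ - f₁)
  simp_rw [reciprocalFlux, inner_sub_left, real_inner_smul_left]
  rw [integral_sub (hI hM₂ h₂.memLp_p h₁.memLp_v) (hI hM₁ h₁.memLp_p h₂.memLp_v), e₁, e₂, hsym,
    sub_self]

end BarusFlow

/-! ### The area formula for Lipschitz graphs -/

namespace BarusFlow

open Module
open scoped ENNReal NNReal Function

set_option linter.unusedSectionVars false

section Area

variable {H E : Type*} [NormedAddCommGroup H] [InnerProductSpace ℝ H] [FiniteDimensional ℝ H]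
  [CompleteSpace H] [MeasurableSpace H] [BorelSpace H]
  [NormedAddCommGroup E] [InnerProductSpace ℝ E] [MeasurableSpace E] [BorelSpace E]

/-- The parametrisation `x ↦ x + f(x) e` of the graph of `f` in direction `e`, where the domain
`H` of `f` is embedded isometrically by `j`. -/
def graphMap (j : H →ₗᵢ[ℝ] E) (e : E) (f : H → ℝ) (x : H) : E := j x + f x • e

/-- The area density of a graph with slope `a`. -/
noncomputable def areaDensity (a : H) : ℝ := √(1 + ‖a‖ ^ 2)

theorem one_le_areaDensity (a : H) : 1 ≤ areaDensity a :=
  Real.one_le_sqrt.2 (by nlinarith [sq_nonneg ‖a‖])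

theorem areaDensity_le_add (a b : H) : areaDensity a ≤ areaDensity b + ‖a - b‖ := by
  have h1 : 0 ≤ ‖a - b‖ := norm_nonneg _
  have h2 : ‖a‖ ≤ ‖b‖ + ‖a - b‖ := by
    have := norm_add_le b (a - b); simpa using this
  have h3 : ‖b‖ ≤ areaDensity b := Real.le_sqrt_of_sq_le (by linarith)
  have h4 : areaDensity b ^ 2 = 1 + ‖b‖ ^ 2 := Real.sq_sqrt (by positivity)
  refine Real.sqrt_le_iff.2 ⟨by linarith [one_le_areaDensity b], ?_⟩
  nlinarith [norm_nonneg a, norm_nonneg b]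

theorem areaDensity_le_mul {a b : H} {δ : ℝ} (h : ‖a - b‖ ≤ δ) :
    areaDensity a ≤ (1 + δ) * areaDensity b := by
  have := areaDensity_le_add a b
  nlinarith [one_le_areaDensity b, norm_nonneg (a - b)]

variable {j : H →ₗᵢ[ℝ] E} {e : E}

theorem norm_sq_add_smul (he : ‖e‖ = 1) (horth : ∀ x, inner ℝ (j x) e = 0) (x : H) (t : ℝ) :
    ‖j x + t • e‖ ^ 2 = ‖x‖ ^ 2 + t ^ 2 := by
  rw [norm_add_sq_real, inner_smul_right, horth, norm_smul, he, j.norm_map]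
  simp

theorem graphMap_sub (f : H → ℝ) (x y : H) :
    graphMap j e f x - graphMap j e f y = j (x - y) + (f x - f y) • e := by
  simp only [graphMap, map_sub, sub_smul]; abel

theorem graphMap_injective (he : ‖e‖ = 1) (horth : ∀ x, inner ℝ (j x) e = 0) (f : H → ℝ) :
    Function.Injective (graphMap j e f) := by
  intro x y hxy
  have h := norm_sq_add_smul he horth (x - y) (f x - f y)
  rw [← graphMap_sub, hxy, sub_self, norm_zero] at h
  have : ‖x - y‖ ^ 2 = 0 := by nlinarith [sq_nonneg ‖x - y‖, sq_nonneg (f x - f y)]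
  simpa [sub_eq_zero] using this

theorem continuous_graphMap {f : H → ℝ} (hf : Continuous f) : Continuous (graphMap j e f) :=
  j.continuous.add (hf.smul continuous_const)

theorem measurableEmbedding_graphMap (he : ‖e‖ = 1) (horth : ∀ x, inner ℝ (j x) e = 0)
    {f : H → ℝ} (hf : Continuous f) : MeasurableEmbedding (graphMap j e f) := by
  have : SecondCountableTopology H := secondCountable_of_proper
  exact (continuous_graphMap hf).measurableEmbedding (graphMap_injective he horth f)

/-- The linear graph of slope `a`. -/
noncomputable def linearGraph (j : H →ₗᵢ[ℝ] E) (e : E) (a : H) : H →ₗ[ℝ] E :=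
  j.toLinearMap + ((innerSL ℝ a).toLinearMap).smulRight e

theorem linearGraph_apply (a x : H) : linearGraph j e a x = j x + inner ℝ a x • e := by
  simp [linearGraph]

theorem normDet_linearGraph (he : ‖e‖ = 1) (horth : ∀ x, inner ℝ (j x) e = 0) (a : H) :
    (linearGraph j e a).normDet = areaDensity a := by
  rw [areaDensity, eq_comm, Real.sqrt_eq_iff_mul_self_eq (by positivity)
    (LinearMap.normDet_nonneg _), ← pow_two, eq_comm]
  let b := stdOrthonormalBasis ℝ H
  have h := (linearGraph j e a).normDet_sq_eq_det_gram b
  have hg : Matrix.gram ℝ (fun i => linearGraph j e a (b i))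
      = 1 + Matrix.replicateCol Unit (fun i => inner ℝ a (b i))
        * Matrix.replicateRow Unit (fun i => inner ℝ a (b i)) := by
    ext i k
    have ho : inner ℝ (b i) (b k) = (1 : Matrix _ _ ℝ) i k := by
      rw [Matrix.one_apply]; exact (orthonormal_iff_ite.1 b.orthonormal) i k
    have h1 := horth (b i)
    have h2 := horth (b k)
    rw [real_inner_comm] at h2
    simp [Matrix.gram_apply, linearGraph_apply, inner_add_left, inner_add_right, inner_smul_left,
      inner_smul_right, Matrix.mul_apply, ho, h1, h2, he]
    ring
  rw [hg, Matrix.det_one_add_replicateCol_mul_replicateRow] at h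
  have hs : (fun i => inner ℝ a (b i)) ⬝ᵥ (fun i => inner ℝ a (b i)) = ‖a‖ ^ 2 := by
    rw [← b.sum_sq_norm_inner_right a]
    simp [dotProduct, pow_two, real_inner_comm]
  rw [hs] at h
  exact_mod_cast h

/-- A map that expands distances at most `C` times as much as `k` expands Hausdorff measure at most
`C ^ n` times as much. -/
theorem euclideanHausdorffMeasure_image_le_of_dist_le {X : Type*} {k g : X → E} {s : Set X}
    {C : ℝ≥0} (n : ℕ) (h : ∀ x ∈ s, ∀ y ∈ s, dist (g x) (g y) ≤ C * dist (k x) (k y)) :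
    μHE[n] (g '' s) ≤ (C : ℝ≥0∞) ^ n * μHE[n] (k '' s) := by
  rcases s.eq_empty_or_nonempty with rfl | ⟨x₀, hx₀⟩
  · simp
  have : Nonempty X := ⟨x₀⟩
  let r : E → E := fun z => g (Function.invFunOn k s z)
  have hr : LipschitzOnWith C r (k '' s) := by
    refine LipschitzOnWith.of_dist_le_mul fun z hz w hw => ?_
    have := h _ (Function.invFunOn_mem hz) _ (Function.invFunOn_mem hw)
    rwa [Function.invFunOn_eq hz, Function.invFunOn_eq hw] at this
  have himg : g '' s ⊆ r '' (k '' s) := by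
    rintro _ ⟨x, hx, rfl⟩
    have hz : k x ∈ k '' s := ⟨x, hx, rfl⟩
    refine ⟨k x, hz, ?_⟩
    have := h _ (Function.invFunOn_mem hz) x hx
    rw [Function.invFunOn_eq hz, dist_self, mul_zero] at this
    exact dist_le_zero.1 this
  have key := (measure_mono himg).trans (hr.hausdorffMeasure_image_le (d := n) (by positivity))
  simp only [Measure.euclideanHausdorffMeasure_def, Measure.smul_apply, ENNReal.smul_def,
    smul_eq_mul]
  rw [ENNReal.rpow_natCast] at key
  calc _ ≤ _ := mul_le_mul_right key _
    _ = _ := by ring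

theorem dist_graphMap_le {f : H → ℝ} {a x y : H} {δ : ℝ≥0} (he : ‖e‖ = 1)
    (horth : ∀ x, inner ℝ (j x) e = 0) (h : ‖f x - f y - inner ℝ a (x - y)‖ ≤ δ * ‖x - y‖) :
    dist (graphMap j e f x) (graphMap j e f y) ≤
        (1 + δ : ℝ≥0) * dist (linearGraph j e a x) (linearGraph j e a y) ∧
      dist (linearGraph j e a x) (linearGraph j e a y) ≤
        (1 + δ : ℝ≥0) * dist (graphMap j e f x) (graphMap j e f y) := by
  have hd : (graphMap j e f x - graphMap j e f y) - (linearGraph j e a x - linearGraph j e a y)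
      = (f x - f y - inner ℝ a (x - y)) • e := by
    rw [graphMap_sub, ← map_sub, linearGraph_apply, sub_smul _ (inner ℝ a (x - y))]; abel
  have hn : ‖(graphMap j e f x - graphMap j e f y) - (linearGraph j e a x - linearGraph j e a y)‖
      ≤ δ * ‖x - y‖ := by rw [hd, norm_smul, he, mul_one]; exact h
  have hle : ∀ t : ℝ, ‖x - y‖ ≤ ‖j (x - y) + t • e‖ := fun t => by
    refine le_of_sq_le_sq ?_ (norm_nonneg _)
    rw [norm_sq_add_smul he horth]; nlinarith [sq_nonneg t]
  have h1 := hle (f x - f y)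
  have h2 := hle (inner ℝ a (x - y))
  rw [← graphMap_sub] at h1
  rw [← linearGraph_apply, map_sub] at h2
  have hn' := hn
  rw [norm_sub_rev] at hn'
  have t1 := norm_le_norm_add_norm_sub (linearGraph j e a x - linearGraph j e a y)
    (graphMap j e f x - graphMap j e f y)
  have t2 := norm_le_norm_add_norm_sub (graphMap j e f x - graphMap j e f y)
    (linearGraph j e a x - linearGraph j e a y)
  have hδ : (0 : ℝ) ≤ δ := δ.2
  push_cast
  rw [dist_eq_norm, dist_eq_norm]
  constructor <;> nlinarith

/-- Differentiability points of `f` split into countably many measurable pieces on which `f` is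
nearly linear and its gradient nearly constant. -/
theorem exists_partition_nearly_linear {f : H → ℝ} {s : Set H} (hs : MeasurableSet s)
    (hf : ∀ x ∈ s, DifferentiableAt ℝ f x) {δ : ℝ≥0} (hδ : 0 < δ) :
    ∃ (P : ℕ → Set H) (a : ℕ → H), Pairwise (Disjoint on P) ∧ (∀ i, MeasurableSet (P i)) ∧
      s = ⋃ i, P i ∧ ∀ i, (∀ x ∈ P i, ‖∇ f x - a i‖ ≤ 2 * δ) ∧
        ∀ x ∈ P i, ∀ y ∈ P i, ‖f x - f y - inner ℝ (a i) (x - y)‖ ≤ δ * ‖x - y‖ := by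
  have : SecondCountableTopology H := secondCountable_of_proper
  have hgm : Measurable (∇ f) :=
    (InnerProductSpace.toDual ℝ H).symm.continuous.measurable.comp (measurable_fderiv ℝ f)
  let c := TopologicalSpace.denseSeq H
  let D₀ : ℕ → Set H := fun k => (∇ f) ⁻¹' Metric.ball (c k) δ
  have hD₀m : ∀ k, MeasurableSet (D₀ k) := fun k => hgm Metric.isOpen_ball.measurableSet
  have hD₀u : ⋃ k, D₀ k = univ := by
    refine eq_univ_of_forall fun x => ?_
    obtain ⟨k, hk⟩ := (TopologicalSpace.denseRange_denseSeq H).exists_dist_lt (∇ f x)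
      (NNReal.coe_pos.2 hδ)
    exact mem_iUnion.2 ⟨k, hk⟩
  let D : ℕ → Set H := fun k => s ∩ disjointed D₀ k
  have hDm : ∀ k, MeasurableSet (D k) := fun k =>
    hs.inter (MeasurableSet.disjointed hD₀m k)
  have hDu : s = ⋃ k, D k := by
    rw [← inter_iUnion, iUnion_disjointed, hD₀u, inter_univ]
  have hD : ∀ k, ∀ x ∈ D k, dist (∇ f x) (c k) < δ := fun k x hx =>
    disjointed_subset D₀ k hx.2
  have hpart : ∀ k, ∃ (t : ℕ → Set H) (A : ℕ → H →L[ℝ] ℝ), Pairwise (Disjoint on t) ∧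
      (∀ n, MeasurableSet (t n)) ∧ (D k ⊆ ⋃ n, t n) ∧
      (∀ n, ApproximatesLinearOn f (A n) (D k ∩ t n) δ) ∧
      ((D k).Nonempty → ∀ n, ∃ y ∈ D k, A n = fderiv ℝ f y) := fun k =>
    exists_partition_approximatesLinearOn_of_hasFDerivWithinAt f (D k) (fderiv ℝ f)
      (fun x hx => (hf x hx.1).hasFDerivAt.hasFDerivWithinAt) (fun _ => δ) fun _ => hδ.ne'
  choose t A htd htm htc htA hA using hpart
  let φ := Nat.unpair
  refine ⟨fun i => D (φ i).1 ∩ t (φ i).1 (φ i).2, fun i => (InnerProductSpace.toDual ℝ H).symm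
    (A (φ i).1 (φ i).2), ?_, fun i => (hDm _).inter (htm _ _), ?_, fun i => ⟨fun x hx => ?_,
    fun x hx y hy => ?_⟩⟩
  · intro i k hik
    have hne : φ i ≠ φ k := fun h => hik (Nat.pairEquiv.symm.injective h)
    by_cases h1 : (φ i).1 = (φ k).1
    · have h2 : (φ i).2 ≠ (φ k).2 := fun h2 => hne (Prod.ext h1 h2)
      have := htd (φ k).1 h2
      simp only [Function.onFun]
      rw [h1]
      exact this.mono inter_subset_right inter_subset_right
    · exact (disjoint_disjointed D₀ h1).mono (inter_subset_left.trans inter_subset_right)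
        (inter_subset_left.trans inter_subset_right)
  · refine Subset.antisymm (fun x hx => ?_) (iUnion_subset fun i x hx => hx.1.1)
    rw [hDu] at hx
    obtain ⟨k, hk⟩ := mem_iUnion.1 hx
    obtain ⟨n, hn⟩ := mem_iUnion.1 (htc k hk)
    refine mem_iUnion.2 ⟨Nat.pair k n, ?_⟩
    simp only [φ, Nat.unpair_pair]
    exact ⟨hk, hn⟩
  · obtain ⟨y, hy, hAy⟩ := hA (φ i).1 ⟨x, hx.1⟩ (φ i).2
    simp only []
    rw [hAy, ← dist_eq_norm]
    refine (dist_triangle_right _ _ (c (φ i).1)).trans ?_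
    have h1 := hD _ x hx.1
    have h2 := hD _ y hy
    rw [gradient] at h2
    linarith
  · have := htA (φ i).1 (φ i).2 x hx y hy
    rwa [InnerProductSpace.toDual_symm_apply]

/-- A graph over a piece on which `f` is nearly linear has nearly the area given by the density. -/
theorem graphMap_image_piece (he : ‖e‖ = 1) (horth : ∀ x, inner ℝ (j x) e = 0) {f : H → ℝ}
    {P : Set H} {a : H} {δ : ℝ≥0} (hP : MeasurableSet P) (h1 : ∀ x ∈ P, ‖∇ f x - a‖ ≤ 2 * δ)
    (h2 : ∀ x ∈ P, ∀ y ∈ P, ‖f x - f y - inner ℝ a (x - y)‖ ≤ δ * ‖x - y‖) :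
    μHE[finrank ℝ H] (graphMap j e f '' P) ≤ ((1 + 2 * δ : ℝ≥0) : ℝ≥0∞) ^ (finrank ℝ H + 1) *
        ∫⁻ x in P, ENNReal.ofReal (areaDensity (∇ f x)) ∧
      ∫⁻ x in P, ENNReal.ofReal (areaDensity (∇ f x)) ≤
        ((1 + 2 * δ : ℝ≥0) : ℝ≥0∞) ^ (finrank ℝ H + 1) * μHE[finrank ℝ H] (graphMap j e f '' P) := by
  have hL : μHE[finrank ℝ H] (linearGraph j e a '' P)
      = ENNReal.ofReal (areaDensity a) * volume P := by
    rw [LinearMap.euclideanHausdorffMeasure_image_eq_normDet_mul_volume,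
      normDet_linearGraph he horth]
  have hconst : ENNReal.ofReal (areaDensity a) * volume P
      = ∫⁻ _ in P, ENNReal.ofReal (areaDensity a) := by
    rw [setLIntegral_const]
  have hmul : ∀ b c : H, ‖b - c‖ ≤ 2 * δ → ENNReal.ofReal (areaDensity b) ≤
      ((1 + 2 * δ : ℝ≥0) : ℝ≥0∞) * ENNReal.ofReal (areaDensity c) := fun b c hbc => by
    rw [← ENNReal.ofReal_coe_nnreal, ← ENNReal.ofReal_mul (by positivity)]
    refine ENNReal.ofReal_le_ofReal ((areaDensity_le_mul hbc).trans (le_of_eq ?_))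
    push_cast; ring
  have hδ : ((1 + δ : ℝ≥0) : ℝ≥0∞) ≤ ((1 + 2 * δ : ℝ≥0) : ℝ≥0∞) := by
    refine ENNReal.coe_le_coe.2 (by gcongr; exact le_mul_of_one_le_left' (by norm_num))
  constructor
  · calc μHE[finrank ℝ H] (graphMap j e f '' P)
        ≤ ((1 + δ : ℝ≥0) : ℝ≥0∞) ^ finrank ℝ H * μHE[finrank ℝ H] (linearGraph j e a '' P) :=
          euclideanHausdorffMeasure_image_le_of_dist_le _ fun x hx y hy =>
            (dist_graphMap_le he horth (h2 x hx y hy)).1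
      _ ≤ ((1 + 2 * δ : ℝ≥0) : ℝ≥0∞) ^ finrank ℝ H *
          (((1 + 2 * δ : ℝ≥0) : ℝ≥0∞) * ∫⁻ x in P, ENNReal.ofReal (areaDensity (∇ f x))) := by
          gcongr
          rw [hL, hconst, ← lintegral_const_mul' _ _ ENNReal.coe_ne_top]
          refine setLIntegral_mono' hP fun x hx => hmul _ _ ?_
          rw [norm_sub_rev]; exact h1 x hx
      _ = _ := by rw [pow_succ, mul_assoc]
  · calc ∫⁻ x in P, ENNReal.ofReal (areaDensity (∇ f x))
        ≤ ((1 + 2 * δ : ℝ≥0) : ℝ≥0∞) * μHE[finrank ℝ H] (linearGraph j e a '' P) := by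
          rw [hL, hconst, ← lintegral_const_mul' _ _ ENNReal.coe_ne_top]
          exact setLIntegral_mono' hP fun x hx => hmul _ _ (h1 x hx)
      _ ≤ ((1 + 2 * δ : ℝ≥0) : ℝ≥0∞) * (((1 + 2 * δ : ℝ≥0) : ℝ≥0∞) ^ finrank ℝ H *
          μHE[finrank ℝ H] (graphMap j e f '' P)) := by
          gcongr
          refine (euclideanHausdorffMeasure_image_le_of_dist_le _ fun x hx y hy =>
            (dist_graphMap_le he horth (h2 x hx y hy)).2).trans ?_
          gcongr
      _ = _ := by rw [pow_succ]; ring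

/-- The area formula over a set of differentiability points: the relative errors of `δ` on nearly
linear pieces add up to a relative error that tends to zero with `δ`. -/
theorem graphMap_image_of_differentiableAt (he : ‖e‖ = 1)
    (horth : ∀ x, inner ℝ (j x) e = 0) {f : H → ℝ} (hf : Continuous f)
    {s : Set H} (hs : MeasurableSet s) (hd : ∀ x ∈ s, DifferentiableAt ℝ f x) :
    μHE[finrank ℝ H] (graphMap j e f '' s)
      = ∫⁻ x in s, ENNReal.ofReal (areaDensity (∇ f x)) := by
  have hg := measurableEmbedding_graphMap he horth hf
  have key : ∀ δ : ℝ≥0, 0 < δ →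
      μHE[finrank ℝ H] (graphMap j e f '' s) ≤ ((1 + 2 * δ : ℝ≥0) : ℝ≥0∞) ^ (finrank ℝ H + 1) *
        ∫⁻ x in s, ENNReal.ofReal (areaDensity (∇ f x)) ∧
      ∫⁻ x in s, ENNReal.ofReal (areaDensity (∇ f x)) ≤
        ((1 + 2 * δ : ℝ≥0) : ℝ≥0∞) ^ (finrank ℝ H + 1) *
          μHE[finrank ℝ H] (graphMap j e f '' s) := by
    intro δ hδ
    obtain ⟨P, a, hPd, hPm, hPs, hP⟩ := exists_partition_nearly_linear hs hd hδ
    have e1 : μHE[finrank ℝ H] (graphMap j e f '' s)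
        = ∑' i, μHE[finrank ℝ H] (graphMap j e f '' P i) := by
      rw [hPs, image_iUnion, measure_iUnion]
      · exact fun i k hik => (disjoint_image_iff hg.injective).2 (hPd hik)
      · exact fun i => hg.measurableSet_image.2 (hPm i)
    have e2 : ∫⁻ x in s, ENNReal.ofReal (areaDensity (∇ f x))
        = ∑' i, ∫⁻ x in P i, ENNReal.ofReal (areaDensity (∇ f x)) := by
      rw [hPs, lintegral_iUnion hPm hPd]
    rw [e1, e2, ← ENNReal.tsum_mul_left, ← ENNReal.tsum_mul_left]
    exact ⟨ENNReal.tsum_le_tsum fun i =>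
        (graphMap_image_piece he horth (hPm i) (hP i).1 (hP i).2).1,
      ENNReal.tsum_le_tsum fun i =>
        (graphMap_image_piece he horth (hPm i) (hP i).1 (hP i).2).2⟩
  have hlim : ∀ X : ℝ≥0∞, Tendsto (fun δ : ℝ≥0 =>
      ((1 + 2 * δ : ℝ≥0) : ℝ≥0∞) ^ (finrank ℝ H + 1) * X) (𝓝[>] 0) (𝓝 X) := by
    intro X
    have h1 : Tendsto (fun δ : ℝ≥0 => (((1 + 2 * δ) ^ (finrank ℝ H + 1) : ℝ≥0) : ℝ≥0∞)) (𝓝[>] 0)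
        (𝓝 (1 : ℝ≥0∞)) := by
      have hc : Continuous fun δ : ℝ≥0 => (1 + 2 * δ) ^ (finrank ℝ H + 1) := by fun_prop
      have := (ENNReal.tendsto_coe.2 (hc.tendsto 0)).mono_left
        (nhdsWithin_le_nhds (s := Ioi 0))
      simpa using this
    have := ENNReal.Tendsto.mul_const (b := X) h1 (Or.inl one_ne_zero)
    simpa using this
  exact le_antisymm
    (ge_of_tendsto (hlim _) (eventually_nhdsWithin_of_forall fun δ hδ => (key δ hδ).1))
    (ge_of_tendsto (hlim _) (eventually_nhdsWithin_of_forall fun δ hδ => (key δ hδ).2))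

/-- **Area formula for Lipschitz graphs.** -/
theorem euclideanHausdorffMeasure_graphMap_image (he : ‖e‖ = 1)
    (horth : ∀ x, inner ℝ (j x) e = 0) {f : H → ℝ} {C : ℝ≥0} (hf : LipschitzWith C f)
    {s : Set H} (hs : MeasurableSet s) :
    μHE[finrank ℝ H] (graphMap j e f '' s)
      = ∫⁻ x in s, ENNReal.ofReal (areaDensity (∇ f x)) := by
  set D : Set H := {x | DifferentiableAt ℝ f x} with hD
  have hDm : MeasurableSet D := measurableSet_of_differentiableAt ℝ f
  have hN : volume (s \ D) = 0 :=
    measure_mono_null (fun x hx => hx.2) (ae_iff.1 (hf.ae_differentiableAt (μ := volume)))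
  have hgN : μHE[finrank ℝ H] (graphMap j e f '' (s \ D)) = 0 := by
    refine le_antisymm ?_ zero_le
    refine (euclideanHausdorffMeasure_image_le_of_dist_le (k := linearGraph j e 0) (C := 1 + C) _
      fun x _ y _ => (dist_graphMap_le he horth ?_).1).trans ?_
    · simpa using hf.norm_sub_le x y
    · rw [LinearMap.euclideanHausdorffMeasure_image_eq_normDet_mul_volume, hN]
      simp
  have h1 := graphMap_image_of_differentiableAt he horth hf.continuous (hs.inter hDm)
    fun x hx => hx.2
  have hsplit : graphMap j e f '' s = graphMap j e f '' (s ∩ D) ∪ graphMap j e f '' (s \ D) := by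
    rw [← image_union, inter_union_sdiff]
  have hae : (s ∩ D : Set H) =ᵐ[volume] s := inter_ae_eq_left_of_ae_eq_univ
    (eventuallyEq_univ.2 (hf.ae_differentiableAt (μ := volume)))
  rw [← setLIntegral_congr hae, ← h1, hsplit]
  exact le_antisymm ((measure_union_le _ _).trans (by rw [hgN, add_zero]))
    (measure_mono subset_union_left)

/-- Surface integrals over a Lipschitz graph as integrals over its domain. -/
theorem setIntegral_range_graphMap (he : ‖e‖ = 1) (horth : ∀ x, inner ℝ (j x) e = 0) {f : H → ℝ}
    {C : ℝ≥0} (hf : LipschitzWith C f) (h : E → ℝ) :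
    ∫ y in range (graphMap j e f), h y ∂μHE[finrank ℝ H]
      = ∫ x, areaDensity (∇ f x) * h (graphMap j e f x) := by
  have hg := measurableEmbedding_graphMap he horth hf.continuous
  have hJ : Measurable fun x => areaDensity (∇ f x) := by
    have hgm : Measurable (∇ f) :=
      (InnerProductSpace.toDual ℝ H).symm.continuous.measurable.comp (measurable_fderiv ℝ f)
    unfold areaDensity
    exact (measurable_const.add (hgm.norm.pow_const 2)).sqrt
  have hm : (μHE[finrank ℝ H] : Measure E).restrict (range (graphMap j e f))
      = (volume.withDensity fun x => ENNReal.ofReal (areaDensity (∇ f x))).map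
          (graphMap j e f) := by
    ext t ht
    rw [Measure.restrict_apply ht, hg.map_apply, withDensity_apply _ (hg.measurable ht),
      ← euclideanHausdorffMeasure_graphMap_image he horth hf (hg.measurable ht),
      image_preimage_eq_inter_range]
  rw [hm, hg.integral_map]
  have hd : (fun x => ENNReal.ofReal (areaDensity (∇ f x)))
      = fun x => ((Real.toNNReal (areaDensity (∇ f x)) : ℝ≥0) : ℝ≥0∞) := rfl
  rw [hd, integral_withDensity_eq_integral_smul hJ.real_toNNReal]
  refine integral_congr_ae (Eventually.of_forall fun x => ?_)
  simp only [NNReal.smul_def, smul_eq_mul]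
  rw [Real.coe_toNNReal _ (zero_le_one.trans (one_le_areaDensity _))]

end Area

end BarusFlow

/-! ### Graph coordinates and the outward normal -/

namespace BarusFlow

open Module
open scoped ENNReal NNReal Function

section Graph

variable {d : ℕ} {e : Space d} {φ : Space d → ℝ}

theorem inner_coe_orthogonal (x : (ℝ ∙ e)ᗮ) : inner ℝ e (x : Space d) = 0 :=
  Submodule.mem_orthogonal_singleton_iff_inner_right.1 x.2

theorem coe_orthogonalProjection_orthogonal_singleton (he : ‖e‖ = 1) (y : Space d) :
    ((ℝ ∙ e)ᗮ.orthogonalProjectionOnto y : Space d) = y - inner ℝ e y • e := by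
  have h1 : ((ℝ ∙ e)ᗮ.orthogonalProjectionOnto y : Space d) = (ℝ ∙ e)ᗮ.starProjection y := rfl
  rw [h1, Submodule.starProjection_orthogonal_val, Submodule.starProjection_unit_singleton ℝ he]

/-- The signed height of the graph of `φ` above the point `y`, in direction `e`. -/
noncomputable def heightAbove (e : Space d) (φ : Space d → ℝ) (y : Space d) : ℝ :=
  φ (y - inner ℝ e y • e) - inner ℝ e y

theorem heightAbove_add_smul (he : ‖e‖ = 1) (φ : Space d → ℝ) (x : (ℝ ∙ e)ᗮ) (t : ℝ) :
    heightAbove e φ (x + t • e) = φ x - t := by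
  have : inner ℝ e ((x : Space d) + t • e) = t := by
    rw [inner_add_right, inner_coe_orthogonal, inner_smul_right, real_inner_self_eq_norm_sq, he]
    simp
  rw [heightAbove, this, add_sub_cancel_right]

theorem lipschitzWith_heightAbove (he : ‖e‖ = 1) {C : ℝ≥0} (hφ : LipschitzWith C φ) :
    LipschitzWith (C + 1) (heightAbove e φ) := by
  have h1 : LipschitzWith 1 fun y : Space d => y - inner ℝ e y • e := by
    refine LipschitzWith.of_dist_le_mul fun y z => ?_
    rw [← coe_orthogonalProjection_orthogonal_singleton he,
      ← coe_orthogonalProjection_orthogonal_singleton he, dist_eq_norm, dist_eq_norm,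
      ← Submodule.coe_sub, ← map_sub, NNReal.coe_one, one_mul]
    exact ((ℝ ∙ e)ᗮ).norm_orthogonalProjectionOnto_apply_le _
  have h2 : LipschitzWith 1 fun y : Space d => inner ℝ e y := by
    refine LipschitzWith.of_dist_le_mul fun y z => ?_
    rw [Real.dist_eq, ← inner_sub_right, dist_eq_norm, NNReal.coe_one]
    exact (abs_real_inner_le_norm _ _).trans (by rw [he])
  have := (hφ.comp h1).sub h2
  rwa [mul_one] at this

/-- The normal field `e - ∇φ` of the graph of `φ`, of length the area density. -/
noncomputable def graphNormal (e : Space d) (φ : Space d → ℝ) (x : (ℝ ∙ e)ᗮ) : Space d :=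
  e - (∇ (fun z : (ℝ ∙ e)ᗮ => φ z) x : (ℝ ∙ e)ᗮ)

theorem norm_graphNormal (he : ‖e‖ = 1) (φ : Space d → ℝ) (x : (ℝ ∙ e)ᗮ) :
    ‖graphNormal e φ x‖ = areaDensity (∇ (fun z : (ℝ ∙ e)ᗮ => φ z) x) := by
  rw [areaDensity, eq_comm, Real.sqrt_eq_iff_mul_self_eq (by positivity) (norm_nonneg _),
    ← pow_two, graphNormal, norm_sub_sq_real, inner_coe_orthogonal, he]
  simp

theorem hasGradientAt_heightAbove (he : ‖e‖ = 1) (x : (ℝ ∙ e)ᗮ) (t : ℝ)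
    (h : DifferentiableAt ℝ (fun z : (ℝ ∙ e)ᗮ => φ z) x) :
    HasGradientAt (heightAbove e φ) (-graphNormal e φ x) (x + t • e) := by
  have hP : (ℝ ∙ e)ᗮ.orthogonalProjectionOnto ((x : Space d) + t • e) = x := by
    apply Subtype.ext
    rw [coe_orthogonalProjection_orthogonal_singleton he, inner_add_right, inner_coe_orthogonal,
      inner_smul_right, real_inner_self_eq_norm_sq, he]
    simp
  have hc : heightAbove e φ = fun y => (fun z : (ℝ ∙ e)ᗮ => φ z)
      ((ℝ ∙ e)ᗮ.orthogonalProjectionOnto y) - innerSL ℝ e y := by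
    ext y
    simp only [heightAbove, coe_orthogonalProjection_orthogonal_singleton he, innerSL_apply_apply]
  rw [hasGradientAt_iff_hasFDerivAt, hc]
  have h' : HasFDerivAt (fun z : (ℝ ∙ e)ᗮ => φ z) (fderiv ℝ (fun z : (ℝ ∙ e)ᗮ => φ z) x)
      ((ℝ ∙ e)ᗮ.orthogonalProjectionOnto ((x : Space d) + t • e)) := by
    rw [hP]; exact h.hasFDerivAt
  refine ((h'.comp _ ((ℝ ∙ e)ᗮ.orthogonalProjectionOnto).hasFDerivAt).sub
    (innerSL ℝ e).hasFDerivAt).congr_fderiv ?_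
  ext w
  simp only [graphNormal, neg_sub, InnerProductSpace.toDual_apply_apply, inner_sub_left,
    ContinuousLinearMap.comp_apply, sub_apply, innerSL_apply_apply]
  rw [← Submodule.inner_orthogonalProjectionOnto_eq_of_mem_left, inner_gradient_left]

/-- Graph coordinates `(x, s) ↦ x + (φ(x) - s) e`, where `s` is the depth below the graph. -/
def graphCoord (e : Space d) (φ : Space d → ℝ) (q : (ℝ ∙ e)ᗮ × ℝ) : Space d :=
  q.1 + (φ q.1 - q.2) • e

theorem heightAbove_graphCoord (he : ‖e‖ = 1) (q : (ℝ ∙ e)ᗮ × ℝ) :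
    heightAbove e φ (graphCoord e φ q) = q.2 := by
  rw [graphCoord, heightAbove_add_smul he]; ring

theorem exists_graphCoord_eq (he : ‖e‖ = 1) (y : Space d) :
    ∃ x : (ℝ ∙ e)ᗮ, graphCoord e φ (x, heightAbove e φ y) = y := by
  refine ⟨(ℝ ∙ e)ᗮ.orthogonalProjectionOnto y, ?_⟩
  simp only [graphCoord, heightAbove, coe_orthogonalProjection_orthogonal_singleton he]
  simp

theorem continuous_graphCoord (hφ : Continuous φ) : Continuous (graphCoord e φ) := by
  unfold graphCoord; fun_prop

theorem orthogonalProjection_graphCoord (he : ‖e‖ = 1) (q : (ℝ ∙ e)ᗮ × ℝ) :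
    (ℝ ∙ e)ᗮ.orthogonalProjectionOnto (graphCoord e φ q) = q.1 := by
  apply Subtype.ext
  rw [coe_orthogonalProjection_orthogonal_singleton he, graphCoord, inner_add_right,
    inner_coe_orthogonal, inner_smul_right, real_inner_self_eq_norm_sq, he]
  simp

theorem graphCoord_injective (he : ‖e‖ = 1) : Function.Injective (graphCoord e φ) := by
  rintro q r h
  refine Prod.ext ?_ ?_
  · rw [← orthogonalProjection_graphCoord (φ := φ) he q, h, orthogonalProjection_graphCoord he]
  · rw [← heightAbove_graphCoord (φ := φ) he q, h, heightAbove_graphCoord he]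

theorem graphCoord_zero (x : (ℝ ∙ e)ᗮ) : graphCoord e φ (x, 0)
    = graphMap (ℝ ∙ e)ᗮ.subtypeₗᵢ e (fun z : (ℝ ∙ e)ᗮ => φ z) x := by
  simp [graphCoord, graphMap]

theorem measurePreserving_graphCoord (he : ‖e‖ = 1) (hφ : Continuous φ) :
    MeasurePreserving (graphCoord e φ) (volume.prod volume) volume := by
  have m1 : MeasurePreserving (fun q : (ℝ ∙ e)ᗮ × ℝ => (q.1, φ q.1 - q.2))
      (volume.prod volume) (volume.prod volume) := by
    refine (MeasurePreserving.id (volume : Measure (ℝ ∙ e)ᗮ)).skew_product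
      (g := fun x s => φ x - s) ?_ ?_
    · exact Continuous.measurable (by unfold Function.uncurry; fun_prop)
    · exact Eventually.of_forall fun x => (Measure.measurePreserving_sub_left volume (φ x)).map_eq
  have m2 : MeasurePreserving (Prod.map (LinearIsometryEquiv.toSpanUnitSingleton (𝕜 := ℝ) e he)
      (id : (ℝ ∙ e)ᗮ → (ℝ ∙ e)ᗮ)) (volume.prod volume) (volume.prod volume) :=
    (LinearIsometryEquiv.measurePreserving _).prod (MeasurePreserving.id _)
  have m3 := ((ℝ ∙ e).measurePreserving_measurableEquivProd (0 : Space d)).symm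
  rw [InnerProductSpace.euclideanHausdorffMeasure_eq_volume] at m3
  have := m3.comp (m2.comp (Measure.measurePreserving_swap.comp m1))
  have heq : graphCoord e φ = (((ℝ ∙ e).measurableEquivProd (0 : Space d)).symm ∘
      Prod.map (LinearIsometryEquiv.toSpanUnitSingleton (𝕜 := ℝ) e he)
        (id : (ℝ ∙ e)ᗮ → (ℝ ∙ e)ᗮ) ∘ Prod.swap ∘ fun q => (q.1, φ q.1 - q.2)) := by
    funext q
    simp [graphCoord, add_comm]
  rw [heq]
  exact this

theorem measurableEmbedding_graphCoord (he : ‖e‖ = 1) (hφ : Continuous φ) :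
    MeasurableEmbedding (graphCoord e φ) :=
  (continuous_graphCoord hφ).measurableEmbedding (graphCoord_injective he)

theorem IsOutwardUnitNormal.unique {Ω : Set (Space d)} {x ν ν' : Space d}
    (h : IsOutwardUnitNormal Ω x ν) (h' : IsOutwardUnitNormal Ω x ν') : ν = ν' := by
  by_contra hne
  set w := ν' - ν with hw
  have hwpos : 0 < ‖w‖ := norm_pos_iff.2 (sub_ne_zero.2 (Ne.symm hne))
  have hsq : ‖w‖ ^ 2 = 2 - 2 * inner ℝ ν' ν := by
    rw [hw, norm_sub_sq_real, h.1, h'.1]; ring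
  have i1 : inner ℝ w ν = -(‖w‖ ^ 2 / 2) := by
    rw [hsq, hw, inner_sub_left, real_inner_self_eq_norm_sq, h.1]; ring
  have i2 : inner ℝ w ν' = ‖w‖ ^ 2 / 2 := by
    rw [hsq, hw, inner_sub_left, real_inner_self_eq_norm_sq, h'.1, real_inner_comm]; ring
  -- Moving from `x` in direction `ν' - ν` would lead both into and out of `Ω`.
  have hε : 0 < ‖w‖ / 4 := by positivity
  have hev := (h.2 _ hε).and (h'.2 _ hε)
  have ht : Tendsto (fun t : ℝ => x + t • w) (𝓝[>] 0) (𝓝 x) := by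
    have : Continuous fun t : ℝ => x + t • w := by fun_prop
    simpa using (this.tendsto 0).mono_left nhdsWithin_le_nhds
  obtain ⟨t, ht, htpos⟩ := ((ht.eventually hev).and self_mem_nhdsWithin).exists
  have htpos : 0 < t := htpos
  have hn : ‖x + t • w - x‖ = t * ‖w‖ := by
    rw [add_sub_cancel_left, norm_smul, Real.norm_of_nonneg htpos.le]
  refine ht.2.2 ?_ (ht.1.1 ?_)
  · rw [hn, add_sub_cancel_left, real_inner_smul_left, i2]
    have : 0 < t * ‖w‖ ^ 2 := by positivity
    nlinarith
  · rw [hn, add_sub_cancel_left, real_inner_smul_left, i1]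
    have : 0 < t * ‖w‖ ^ 2 := by positivity
    nlinarith

theorem outwardNormal_eq {Ω : Set (Space d)} {x ν : Space d} (h : IsOutwardUnitNormal Ω x ν) :
    outwardNormal Ω x = ν := by
  have hex : ∃ ν, IsOutwardUnitNormal Ω x ν := ⟨ν, h⟩
  rw [outwardNormal, dif_pos hex]
  exact hex.choose_spec.unique h

/-- A regular point of a defining function has an outward normal, opposite to the gradient. -/
theorem isOutwardUnitNormal_of_hasGradientAt {Ω : Set (Space d)} {x ν : Space d}
    {c : Space d → ℝ} (hc : HasGradientAt c (-ν) x) (hc0 : c x = 0) (hν : ν ≠ 0)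
    (hΩ : ∀ᶠ y in 𝓝 x, y ∈ Ω ↔ 0 < c y) : IsOutwardUnitNormal Ω x (‖ν‖⁻¹ • ν) := by
  have hpos : 0 < ‖ν‖ := norm_pos_iff.2 hν
  refine ⟨by rw [norm_smul, norm_inv, norm_norm, inv_mul_cancel₀ hpos.ne'], fun ε hε => ?_⟩
  have hlo := (hasGradientAt_iff_isLittleO.1 hc).def (c := ε * ‖ν‖ / 2) (by positivity)
  filter_upwards [hΩ, hlo] with y hy hl
  have hin : inner ℝ (y - x) (‖ν‖⁻¹ • ν) = ‖ν‖⁻¹ * inner ℝ ν (y - x) := by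
    rw [real_inner_smul_right, real_inner_comm]
  rw [hc0, sub_zero, inner_neg_left, sub_neg_eq_add, Real.norm_eq_abs] at hl
  rw [hin]
  have hl' := abs_le.1 hl
  have key : ∀ r : ℝ, ‖ν‖⁻¹ * inner ℝ ν (y - x) = r → inner ℝ ν (y - x) = ‖ν‖ * r := by
    rintro r rfl
    rw [mul_inv_cancel_left₀ hpos.ne']
  have hk := key _ rfl
  set r := ‖ν‖⁻¹ * inner ℝ ν (y - x) with hr
  rw [hk] at hl'
  have hnn : 0 ≤ ε * ‖ν‖ * ‖y - x‖ := by positivity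
  constructor
  · intro h
    rw [hy]
    have := mul_lt_mul_of_pos_left h hpos
    nlinarith
  · intro h hyΩ
    rw [hy] at hyΩ
    have := mul_lt_mul_of_pos_left h hpos
    nlinarith

end Graph

end BarusFlow

/-! ### The divergence theorem near a regular boundary point -/

namespace BarusFlow

open Module
open scoped ENNReal NNReal Function

section Local

variable {d : ℕ} {e : Space d} {φ : Space d → ℝ} {Ω N : Set (Space d)}

theorem finrank_orthogonal_span_singleton_space (he : ‖e‖ = 1) :
    finrank ℝ (ℝ ∙ e)ᗮ = d - 1 := by
  have h1 := (ℝ ∙ e).finrank_add_finrank_orthogonal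
  rw [finrank_span_singleton (by rintro rfl; simp at he), finrank_euclideanSpace_fin] at h1
  omega

theorem mem_frontier_iff_heightAbove_eq_zero (hΩ : IsOpen Ω) (he : ‖e‖ = 1) (hφ : Continuous φ)
    (hN : IsOpen N) (hgr : ∀ y ∈ N, y ∈ Ω ↔ 0 < heightAbove e φ y) {y : Space d} (hy : y ∈ N) :
    y ∈ frontier Ω ↔ heightAbove e φ y = 0 := by
  have hc : Continuous (heightAbove e φ) := by unfold heightAbove; fun_prop
  rw [hΩ.frontier_eq, Set.mem_sdiff, hgr y hy, not_lt]
  constructor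
  · rintro ⟨hcl, hle⟩
    refine le_antisymm hle (not_lt.1 fun hlt => ?_)
    have hnhds : N ∩ {z | heightAbove e φ z < 0} ∈ 𝓝 y :=
      inter_mem (hN.mem_nhds hy) ((isOpen_lt hc continuous_const).mem_nhds hlt)
    obtain ⟨z, ⟨hzN, hz⟩, hzΩ⟩ := mem_closure_iff_nhds.1 hcl _ hnhds
    exact absurd ((hgr z hzN).1 hzΩ) (not_lt.2 (le_of_lt hz))
  · intro h0
    refine ⟨?_, h0.le⟩
    obtain ⟨x, hx⟩ := exists_graphCoord_eq (φ := φ) he y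
    rw [h0] at hx
    have ht : Tendsto (fun s : ℝ => graphCoord e φ (x, s)) (𝓝[>] 0) (𝓝 y) := by
      have : Continuous fun s : ℝ => graphCoord e φ (x, s) :=
        (continuous_graphCoord hφ).comp (by fun_prop)
      have := (this.tendsto 0).mono_left (nhdsWithin_le_nhds (s := Ioi 0))
      rwa [hx] at this
    refine mem_closure_of_tendsto ht ?_
    filter_upwards [ht.eventually (hN.mem_nhds hy), self_mem_nhdsWithin] with s hs hs0
    rw [hgr _ hs, heightAbove_graphCoord he]
    exact hs0

theorem lipschitzWith_comp_coe_orthogonal {C : ℝ≥0} (hφ : LipschitzWith C φ) :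
    LipschitzWith C fun z : (ℝ ∙ e)ᗮ => φ z :=
  LipschitzWith.of_dist_le_mul fun x y => hφ.dist_le_mul x y

theorem norm_graphNormal_le (he : ‖e‖ = 1) {C : ℝ≥0} (hφ : LipschitzWith C φ) (x : (ℝ ∙ e)ᗮ) :
    ‖graphNormal e φ x‖ ≤ 1 + C := by
  refine (norm_sub_le _ _).trans ?_
  rw [he]
  have : ‖∇ (fun z : (ℝ ∙ e)ᗮ => φ z) x‖ ≤ C := by
    rw [gradient, LinearIsometryEquiv.norm_map]
    exact norm_fderiv_le_of_lipschitz ℝ (lipschitzWith_comp_coe_orthogonal hφ)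
  exact add_le_add_right this 1

theorem measurable_graphNormal (e : Space d) (φ : Space d → ℝ) : Measurable (graphNormal e φ) := by
  have : Measurable (∇ (fun z : (ℝ ∙ e)ᗮ => φ z)) :=
    (InnerProductSpace.toDual ℝ (ℝ ∙ e)ᗮ).symm.continuous.measurable.comp (measurable_fderiv ℝ _)
  exact measurable_const.sub (measurable_subtype_coe.comp this)

theorem ae_differentiableAt_orthogonal {C : ℝ≥0} (hφ : LipschitzWith C φ) :
    ∀ᵐ x : (ℝ ∙ e)ᗮ, DifferentiableAt ℝ (fun z : (ℝ ∙ e)ᗮ => φ z) x := by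
  exact (lipschitzWith_comp_coe_orthogonal hφ).ae_differentiableAt

/-- The flux through a boundary patch, in graph coordinates. -/
theorem integral_surfaceMeasure_eq (hΩ : IsOpen Ω) (he : ‖e‖ = 1) {C : ℝ≥0}
    (hφ : LipschitzWith C φ) (hN : IsOpen N) (hgr : ∀ y ∈ N, y ∈ Ω ↔ 0 < heightAbove e φ y)
    {ψ : Space d → ℝ} (hψ : ∀ y ∉ N, ψ y = 0) (w : Space d → Space d) :
    ∫ y, ψ y * inner ℝ (w y) (outwardNormal Ω y) ∂surfaceMeasure Ω
      = ∫ x : (ℝ ∙ e)ᗮ, ψ (graphCoord e φ (x, 0)) *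
          inner ℝ (w (graphCoord e φ (x, 0))) (graphNormal e φ x) := by
  set f : (ℝ ∙ e)ᗮ → ℝ := fun z => φ z with hf
  have hfl : LipschitzWith C f := lipschitzWith_comp_coe_orthogonal hφ
  have horth : ∀ x, inner ℝ ((ℝ ∙ e)ᗮ.subtypeₗᵢ x) e = 0 := fun x => by
    rw [real_inner_comm]; exact inner_coe_orthogonal x
  have hemb := measurableEmbedding_graphMap he horth hfl.continuous
  have hsw : ∫ y, ψ y * inner ℝ (w y) (outwardNormal Ω y) ∂surfaceMeasure Ω
      = ∫ y in range (graphMap (ℝ ∙ e)ᗮ.subtypeₗᵢ e f), ψ y * inner ℝ (w y) (outwardNormal Ω y)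
          ∂μHE[finrank ℝ (ℝ ∙ e)ᗮ] := by
    rw [surfaceMeasure, finrank_orthogonal_span_singleton_space he,
      ← integral_indicator isClosed_frontier.measurableSet,
      ← integral_indicator hemb.measurableSet_range]
    refine integral_congr_ae (Eventually.of_forall fun y => ?_)
    by_cases hy : y ∈ N
    · have h1 := mem_frontier_iff_heightAbove_eq_zero hΩ he hφ.continuous hN hgr hy
      have h2 : heightAbove e φ y = 0 ↔ y ∈ range (graphMap (ℝ ∙ e)ᗮ.subtypeₗᵢ e f) := by
        constructor
        · intro h0
          obtain ⟨x, hx⟩ := exists_graphCoord_eq (φ := φ) he y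
          rw [h0, graphCoord_zero] at hx
          exact ⟨x, hx⟩
        · rintro ⟨x, rfl⟩
          rw [← graphCoord_zero, heightAbove_graphCoord he]
      by_cases h3 : y ∈ frontier Ω
      · rw [indicator_of_mem h3, indicator_of_mem (h2.1 (h1.1 h3))]
      · rw [indicator_of_notMem h3, indicator_of_notMem fun h => h3 (h1.2 (h2.2 h))]
    · have hz : ∀ T : Set (Space d),
          T.indicator (fun y => ψ y * inner ℝ (w y) (outwardNormal Ω y)) y = 0 := fun T => by
        by_cases h : y ∈ T <;> simp [h, hψ y hy]
      exact (hz _).trans (hz _).symm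
  rw [hsw, setIntegral_range_graphMap he horth hfl]
  refine integral_congr_ae ?_
  filter_upwards [ae_differentiableAt_orthogonal hφ] with x hx
  rw [← graphCoord_zero]
  by_cases hy : graphCoord e φ (x, 0) ∈ N
  · have hg : HasGradientAt (heightAbove e φ) (-graphNormal e φ x) (graphCoord e φ (x, 0)) :=
      hasGradientAt_heightAbove he x _ hx
    have hJ := norm_graphNormal he φ x
    have hJ1 : 1 ≤ ‖graphNormal e φ x‖ := by rw [hJ]; exact one_le_areaDensity _
    have hn : graphNormal e φ x ≠ 0 := norm_pos_iff.1 (by linarith)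
    have := outwardNormal_eq (isOutwardUnitNormal_of_hasGradientAt hg
      (heightAbove_graphCoord he _) hn (by filter_upwards [hN.mem_nhds hy] with z hz using hgr z hz))
    rw [this, ← hJ, inner_smul_right]
    field_simp
  · simp [hψ _ hy]

/-- The cutoff that vanishes above depth `ε` and equals one below depth `2 ε`. -/
noncomputable def ramp (e : Space d) (φ : Space d → ℝ) (ε : ℝ) (y : Space d) : ℝ :=
  max 0 (min 1 (ε⁻¹ * heightAbove e φ y - 1))

theorem ramp_nonneg (ε : ℝ) (y : Space d) : 0 ≤ ramp e φ ε y := le_max_left _ _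

theorem ramp_le_one (ε : ℝ) (y : Space d) : ramp e φ ε y ≤ 1 :=
  max_le zero_le_one (min_le_left _ _)

theorem exists_lipschitzWith_ramp (he : ‖e‖ = 1) {C : ℝ≥0} (hφ : LipschitzWith C φ) (ε : ℝ) :
    ∃ L, LipschitzWith L (ramp e φ ε) := by
  have h1 : LipschitzWith (‖ε⁻¹‖₊ * (C + 1) + 0) fun y => ε⁻¹ * heightAbove e φ y - 1 :=
    ((lipschitzWith_smul ε⁻¹).comp (lipschitzWith_heightAbove he hφ)).sub
      (LipschitzWith.const (1 : ℝ))
  exact ⟨_, (h1.const_min 1).const_max 0⟩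

theorem gradient_ramp (he : ‖e‖ = 1) (hφ : Continuous φ) {ε : ℝ} (hε : 0 < ε) {x : (ℝ ∙ e)ᗮ}
    {s : ℝ} (hx : DifferentiableAt ℝ (fun z : (ℝ ∙ e)ᗮ => φ z) x) (h1 : s ≠ ε) (h2 : s ≠ 2 * ε) :
    ∇ (ramp e φ ε) (graphCoord e φ (x, s))
      = -((Ioo ε (2 * ε)).indicator (fun _ => ε⁻¹) s) • graphNormal e φ x := by
  have hc : Continuous (heightAbove e φ) := by unfold heightAbove; fun_prop
  have hs := heightAbove_graphCoord (φ := φ) he (x, s)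
  simp only at hs
  rcases lt_or_gt_of_ne h1 with h1 | h1
  · have : ramp e φ ε =ᶠ[𝓝 (graphCoord e φ (x, s))] fun _ => 0 := by
      filter_upwards [(isOpen_lt hc continuous_const).mem_nhds (by rwa [mem_ofPred_eq, hs])] with y hy
      have hy : heightAbove e φ y < ε := hy
      have : ε⁻¹ * heightAbove e φ y ≤ 1 := by
        rw [inv_mul_le_iff₀ hε]; linarith
      exact max_eq_left ((min_le_right _ _).trans (by linarith))
    rw [this.gradient_eq, gradient_fun_const,
      indicator_of_notMem (show s ∉ Ioo ε (2 * ε) from fun h => h1.not_gt h.1)]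
    simp
  rcases lt_or_gt_of_ne h2 with h2 | h2
  · have : ramp e φ ε =ᶠ[𝓝 (graphCoord e φ (x, s))] fun y => ε⁻¹ * heightAbove e φ y - 1 := by
      filter_upwards [(isOpen_lt hc continuous_const).mem_nhds
        (show heightAbove e φ (graphCoord e φ (x, s)) < 2 * ε by rwa [hs]),
        (isOpen_lt continuous_const hc).mem_nhds
        (show ε < heightAbove e φ (graphCoord e φ (x, s)) by rwa [hs])] with y hy hy'
      have hy : heightAbove e φ y < 2 * ε := hy
      have hy' : ε < heightAbove e φ y := hy'
      have a1 : ε⁻¹ * heightAbove e φ y ≤ 2 := by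
        rw [inv_mul_le_iff₀ hε]; linarith
      have a2 : 1 ≤ ε⁻¹ * heightAbove e φ y := by
        rw [le_inv_mul_iff₀ hε]; linarith
      rw [ramp, min_eq_right (by linarith), max_eq_right (by linarith)]
    rw [this.gradient_eq, indicator_of_mem (show s ∈ Ioo ε (2 * ε) from ⟨h1, h2⟩)]
    have hg := (hasGradientAt_heightAbove he x (φ x - s) hx).hasFDerivAt
    have hg' : HasGradientAt (fun y => ε⁻¹ * heightAbove e φ y - 1) (-ε⁻¹ • graphNormal e φ x)
        (graphCoord e φ (x, s)) := by
      rw [hasGradientAt_iff_hasFDerivAt]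
      refine ((hg.const_mul ε⁻¹).sub_const 1).congr_fderiv ?_
      ext z
      simp
    exact hg'.gradient
  · have : ramp e φ ε =ᶠ[𝓝 (graphCoord e φ (x, s))] fun _ => 1 := by
      filter_upwards [(isOpen_lt continuous_const hc).mem_nhds
        (show 2 * ε < heightAbove e φ (graphCoord e φ (x, s)) by rwa [hs])] with y hy
      have hy : 2 * ε < heightAbove e φ y := hy
      have : 2 ≤ ε⁻¹ * heightAbove e φ y := by
        rw [le_inv_mul_iff₀ hε]; linarith
      rw [ramp, min_eq_left (by linarith), max_eq_right zero_le_one]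
    rw [this.gradient_eq, gradient_fun_const,
      indicator_of_notMem (show s ∉ Ioo ε (2 * ε) from fun h => h2.not_gt h.2)]
    simp

/-- Rescaling the depth coordinate. -/
theorem integral_prod_scale {H : Type*} [MeasurableSpace H] {μ : Measure H} [SFinite μ] {ε : ℝ}
    (hε : 0 < ε) (F : H × ℝ → ℝ) :
    ∫ p, F p ∂μ.prod volume = ε * ∫ p, F (p.1, ε * p.2) ∂μ.prod volume := by
  have hemb : MeasurableEmbedding (Prod.map (id : H → H) (fun t : ℝ => ε * t)) :=
    ((MeasurableEquiv.refl H).prodCongr (MeasurableEquiv.mulLeft₀ ε hε.ne')).measurableEmbedding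
  have hmap : (μ.prod volume).map (Prod.map (id : H → H) (fun t : ℝ => ε * t))
      = ENNReal.ofReal ε⁻¹ • μ.prod volume := by
    rw [← Measure.map_prod_map _ _ measurable_id (by fun_prop), Measure.map_id,
      Real.map_volume_mul_left hε.ne', Measure.prod_smul_right, abs_of_pos (inv_pos.2 hε)]
  have := hemb.integral_map (μ := μ.prod volume) F
  rw [hmap, integral_smul_measure, ENNReal.toReal_ofReal (inv_pos.2 hε).le] at this
  change _ = ε * ∫ p, F (Prod.map id (fun t : ℝ => ε * t) p) ∂μ.prod volume
  rw [← this, smul_eq_mul, mul_inv_cancel_left₀ hε.ne']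

theorem inner_gradient_mul {f g : Space d → ℝ} {x : Space d} (hf : DifferentiableAt ℝ f x)
    (hg : DifferentiableAt ℝ g x) (w : Space d) :
    inner ℝ w (∇ (fun y => f y * g y) x)
      = f x * inner ℝ w (∇ g x) + g x * inner ℝ w (∇ f x) := by
  have h : fderiv ℝ (fun y => f y * g y) x = f x • fderiv ℝ g x + g x • fderiv ℝ f x :=
    (hf.hasFDerivAt.mul hg.hasFDerivAt).fderiv
  rw [inner_gradient_eq_fderiv, inner_gradient_eq_fderiv, inner_gradient_eq_fderiv, h]
  simp

/-- The product of two bounded Lipschitz functions is Lipschitz. -/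
theorem exists_lipschitzWith_mul {f g : Space d → ℝ} {C D : ℝ≥0} {A B : ℝ}
    (hf : LipschitzWith C f) (hg : LipschitzWith D g) (hA : ∀ x, ‖f x‖ ≤ A) (hB : ∀ x, ‖g x‖ ≤ B) :
    ∃ L, LipschitzWith L fun x => f x * g x := by
  refine ⟨Real.toNNReal (A * D + B * C), LipschitzWith.of_dist_le' fun x y => ?_⟩
  have h1 := hf.dist_le_mul x y
  have h2 := hg.dist_le_mul x y
  rw [Real.dist_eq] at *
  have e : f x * g x - f y * g y = f x * (g x - g y) + g y * (f x - f y) := by ring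
  rw [e]
  refine (abs_add_le _ _).trans ?_
  rw [abs_mul, abs_mul, add_mul, mul_assoc A, mul_assoc B]
  have hA0 := (norm_nonneg _).trans (hA x)
  have hB0 := (norm_nonneg _).trans (hB x)
  exact add_le_add (mul_le_mul (hA x) h2 (abs_nonneg _) hA0)
    (mul_le_mul (hB y) h1 (abs_nonneg _) hB0)

/-- The layer integral against the gradient of the ramp, in rescaled graph coordinates. -/
theorem integral_inner_gradient_ramp (he : ‖e‖ = 1) {C : ℝ≥0} (hφ : LipschitzWith C φ)
    (q : Space d → Space d) {ε : ℝ} (hε : 0 < ε) :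
    ∫ y, inner ℝ (q y) (∇ (ramp e φ ε) y)
      = - ∫ p : (ℝ ∙ e)ᗮ × ℝ, (Ioo (1 : ℝ) 2).indicator (fun _ => (1 : ℝ)) p.2 *
          inner ℝ (q (graphCoord e φ (p.1, ε * p.2))) (graphNormal e φ p.1)
            ∂(volume : Measure (ℝ ∙ e)ᗮ).prod volume := by
  rw [← (measurePreserving_graphCoord he hφ.continuous).integral_comp
    (measurableEmbedding_graphCoord he hφ.continuous)]
  have h1 : ∀ᵐ p : (ℝ ∙ e)ᗮ × ℝ ∂(volume : Measure (ℝ ∙ e)ᗮ).prod volume,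
      DifferentiableAt ℝ (fun z : (ℝ ∙ e)ᗮ => φ z) p.1 :=
    Measure.quasiMeasurePreserving_fst.ae (ae_differentiableAt_orthogonal hφ)
  have h2 : ∀ a : ℝ, ∀ᵐ p : (ℝ ∙ e)ᗮ × ℝ ∂(volume : Measure (ℝ ∙ e)ᗮ).prod volume, p.2 ≠ a :=
    fun a => Measure.quasiMeasurePreserving_snd.ae (Measure.ae_ne volume a)
  have h3 : ∫ p : (ℝ ∙ e)ᗮ × ℝ, inner ℝ (q (graphCoord e φ p))
        (∇ (ramp e φ ε) (graphCoord e φ p)) ∂(volume : Measure (ℝ ∙ e)ᗮ).prod volume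
      = ∫ p : (ℝ ∙ e)ᗮ × ℝ, -((Ioo ε (2 * ε)).indicator (fun _ => ε⁻¹) p.2 *
          inner ℝ (q (graphCoord e φ p)) (graphNormal e φ p.1))
            ∂(volume : Measure (ℝ ∙ e)ᗮ).prod volume := by
    refine integral_congr_ae ?_
    filter_upwards [h1, h2 ε, h2 (2 * ε)] with p hp1 hp2 hp3
    rw [show p = (p.1, p.2) from rfl, gradient_ramp he hφ.continuous hε hp1 hp2 hp3,
      inner_smul_right]
    simp only
    ring
  rw [h3, integral_neg, integral_prod_scale hε, ← integral_const_mul]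
  congr 1
  refine integral_congr_ae (Eventually.of_forall fun p => ?_)
  simp only
  by_cases hp : p.2 ∈ Ioo (1 : ℝ) 2
  · have : ε * p.2 ∈ Ioo ε (2 * ε) := ⟨by nlinarith [hp.1], by nlinarith [hp.2]⟩
    rw [indicator_of_mem hp, indicator_of_mem this, ← mul_assoc, mul_inv_cancel₀ hε.ne']
  · have : ε * p.2 ∉ Ioo ε (2 * ε) := fun h => hp
      ⟨by nlinarith [h.1], by nlinarith [h.2]⟩
    rw [indicator_of_notMem hp, indicator_of_notMem this]
    simp

/-- As the layer shrinks to the graph, the layer integral tends to the flux through the graph. -/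
theorem tendsto_integral_inner_gradient_ramp (hΩ : IsOpen Ω) (he : ‖e‖ = 1) {C : ℝ≥0}
    (hφ : LipschitzWith C φ) (hN : IsOpen N) (hgr : ∀ y ∈ N, y ∈ Ω ↔ 0 < heightAbove e φ y)
    {w : Space d → Space d} (hw : AEStronglyMeasurable w (volume.restrict Ω))
    {M : ℝ} (hM0 : 0 ≤ M) (hM : ∀ y ∈ Ω ∩ N, ‖w y‖ ≤ M)
    (hcont : ∀ y ∈ frontier Ω ∩ N, ContinuousWithinAt w (closure Ω) y)
    {ψ : Space d → ℝ} (hψ : Continuous ψ) (hψs : HasCompactSupport ψ) (hψN : tsupport ψ ⊆ N)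
    {ε : ℕ → ℝ} (hε : ∀ k, 0 < ε k) (hε0 : Tendsto ε atTop (𝓝 0)) :
    Tendsto (fun k => ∫ y, inner ℝ (Ω.indicator (fun y => ψ y • w y) y) (∇ (ramp e φ (ε k)) y))
      atTop (𝓝 (- ∫ x : (ℝ ∙ e)ᗮ, ψ (graphCoord e φ (x, 0)) *
          inner ℝ (w (graphCoord e φ (x, 0))) (graphNormal e φ x))) := by
  set q : Space d → Space d := Ω.indicator (fun y => ψ y • w y) with hq
  simp_rw [integral_inner_gradient_ramp he hφ q (hε _)]
  refine Tendsto.neg ?_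
  have hlimval : ∫ x : (ℝ ∙ e)ᗮ, ψ (graphCoord e φ (x, 0)) *
        inner ℝ (w (graphCoord e φ (x, 0))) (graphNormal e φ x)
      = ∫ p : (ℝ ∙ e)ᗮ × ℝ, (ψ (graphCoord e φ (p.1, 0)) *
        inner ℝ (w (graphCoord e φ (p.1, 0))) (graphNormal e φ p.1)) *
        (Ioo (1 : ℝ) 2).indicator (fun _ => (1 : ℝ)) p.2
          ∂(volume : Measure (ℝ ∙ e)ᗮ).prod volume := by
    rw [integral_prod_mul (fun x : (ℝ ∙ e)ᗮ => ψ (graphCoord e φ (x, 0)) *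
        inner ℝ (w (graphCoord e φ (x, 0))) (graphNormal e φ x))
        ((Ioo (1 : ℝ) 2).indicator (fun _ => (1 : ℝ))), integral_indicator measurableSet_Ioo]
    norm_num
  rw [hlimval]
  obtain ⟨B, hB⟩ := hψ.bounded_above_of_compact_support hψs
  have hqB : ∀ y, ‖q y‖ ≤ B * M ∧ (q y ≠ 0 → y ∈ tsupport ψ) := by
    intro y
    have hB0 := (norm_nonneg _).trans (hB y)
    by_cases hy : y ∈ Ω ∩ tsupport ψ
    · have hwM := hM y ⟨hy.1, hψN hy.2⟩
      refine ⟨?_, fun _ => hy.2⟩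
      rw [hq, indicator_of_mem hy.1, norm_smul]
      exact mul_le_mul (hB y) hwM (norm_nonneg _) hB0
    · have hz : q y = 0 := by
        by_cases hyΩ : y ∈ Ω
        · rw [hq, indicator_of_mem hyΩ, image_eq_zero_of_notMem_tsupport fun h => hy ⟨hyΩ, h⟩,
            zero_smul]
        · rw [hq, indicator_of_notMem hyΩ]
      refine ⟨?_, fun h => absurd hz h⟩
      rw [hz, norm_zero]; exact mul_nonneg hB0 hM0
  have hqm : AEStronglyMeasurable q volume :=
    (aestronglyMeasurable_indicator_iff hΩ.measurableSet).2 (hψ.aestronglyMeasurable.smul hw)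
  set K : Set (ℝ ∙ e)ᗮ := (fun y => (ℝ ∙ e)ᗮ.orthogonalProjectionOnto y) '' tsupport ψ with hK
  have hKc : IsCompact K := hψs.isCompact.image (by fun_prop)
  refine tendsto_integral_of_dominated_convergence
    (fun p => K.indicator (fun _ => B * M * (1 + C)) p.1 *
      (Ioo (1 : ℝ) 2).indicator (fun _ => (1 : ℝ)) p.2) (fun k => ?_) ?_ (fun k => ?_) ?_
  · have hs : AEStronglyMeasurable (fun p : (ℝ ∙ e)ᗮ × ℝ => q (graphCoord e φ (p.1, ε k * p.2)))
        ((volume : Measure (ℝ ∙ e)ᗮ).prod volume) := by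
      have hqΘ := hqm.comp_measurePreserving (measurePreserving_graphCoord he hφ.continuous)
      refine hqΘ.comp_quasiMeasurePreserving
        (f := Prod.map (id : (ℝ ∙ e)ᗮ → (ℝ ∙ e)ᗮ) (fun t : ℝ => ε k * t)) ⟨by fun_prop, ?_⟩
      rw [← Measure.map_prod_map _ _ measurable_id (by fun_prop), Measure.map_id,
        Real.map_volume_mul_left (hε k).ne', Measure.prod_smul_right]
      exact Measure.smul_absolutelyContinuous
    refine AEStronglyMeasurable.mul ?_ (hs.inner ?_)
    · exact ((measurable_const.indicator measurableSet_Ioo).comp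
        measurable_snd).aestronglyMeasurable
    · exact ((measurable_graphNormal e φ).comp measurable_fst).aestronglyMeasurable
  · refine Integrable.mul_prod ?_ ?_
    · exact (integrableOn_const hKc.measure_lt_top.ne).integrable_indicator hKc.measurableSet
    · exact (integrableOn_const (by simp)).integrable_indicator measurableSet_Ioo
  · refine Eventually.of_forall fun p => ?_
    rw [norm_mul, mul_comm]
    refine mul_le_mul ?_ ?_ (norm_nonneg _) ?_
    · by_cases hz : q (graphCoord e φ (p.1, ε k * p.2)) = 0
      · rw [hz, inner_zero_left, norm_zero]
        refine indicator_nonneg (fun _ _ => ?_) _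
        have := (norm_nonneg _).trans (hqB 0).1
        positivity
      · have hpK : p.1 ∈ K := ⟨_, (hqB _).2 hz, orthogonalProjection_graphCoord he _⟩
        rw [indicator_of_mem hpK]
        refine (norm_inner_le_norm _ _).trans (mul_le_mul (hqB _).1
          (norm_graphNormal_le he hφ _) (norm_nonneg _) ((norm_nonneg _).trans (hqB 0).1))
    · by_cases hp : p.2 ∈ Ioo (1 : ℝ) 2
      · simp [hp]
      · simp [hp]
    · refine indicator_nonneg (fun _ _ => ?_) _
      have := (norm_nonneg _).trans (hqB 0).1
      positivity
  · refine Eventually.of_forall fun p => ?_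
    by_cases hp : p.2 ∈ Ioo (1 : ℝ) 2
    swap
    · simp [hp]
    have hpos : 0 < p.2 := by linarith [hp.1]
    simp only [indicator_of_mem hp, one_mul, mul_one]
    rw [← real_inner_smul_left]
    refine Tendsto.inner ?_ tendsto_const_nhds
    set y₀ := graphCoord e φ (p.1, 0) with hy₀
    have hty : Tendsto (fun k => graphCoord e φ (p.1, ε k * p.2)) atTop (𝓝 y₀) := by
      have hc : Continuous fun s : ℝ => graphCoord e φ (p.1, s) :=
        (continuous_graphCoord hφ.continuous).comp (by fun_prop)
      have := (hc.tendsto 0).comp (by simpa using hε0.mul_const p.2 :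
        Tendsto (fun k => ε k * p.2) atTop (𝓝 0))
      exact this
    by_cases hyN : y₀ ∈ N
    · have hfr : y₀ ∈ frontier Ω := (mem_frontier_iff_heightAbove_eq_zero hΩ he hφ.continuous hN
        hgr hyN).2 (heightAbove_graphCoord he _)
      have hin : ∀ᶠ k in atTop, graphCoord e φ (p.1, ε k * p.2) ∈ Ω := by
        filter_upwards [hty.eventually (hN.mem_nhds hyN)] with k hk
        rw [hgr _ hk, heightAbove_graphCoord he]
        exact mul_pos (hε k) hpos
      have hw' : Tendsto (fun k => w (graphCoord e φ (p.1, ε k * p.2))) atTop (𝓝 (w y₀)) :=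
        (hcont y₀ ⟨hfr, hyN⟩).tendsto.comp (tendsto_nhdsWithin_iff.2
          ⟨hty, hin.mono fun k hk => subset_closure hk⟩)
      refine (((hψ.tendsto y₀).comp hty).smul hw').congr' ?_
      filter_upwards [hin] with k hk
      rw [hq, indicator_of_mem hk]; rfl
    · have hyψ : y₀ ∉ tsupport ψ := fun h => hyN (hψN h)
      rw [image_eq_zero_of_notMem_tsupport hyψ, zero_smul]
      refine tendsto_const_nhds.congr' ?_
      filter_upwards [hty.eventually ((isClosed_tsupport ψ).isOpen_compl.mem_nhds hyψ)] with k hk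
      by_contra hne
      exact hk ((hqB _).2 (Ne.symm hne))

/-- The divergence theorem for a divergence-free field near a boundary point, with a Lipschitz
weight `ψ` supported in a graph neighbourhood on which the field is bounded. -/
theorem setIntegral_inner_gradient_eq_surface (hΩ : IsOpen Ω) (he : ‖e‖ = 1) {C : ℝ≥0}
    (hφ : LipschitzWith C φ) (hN : IsOpen N) (hgr : ∀ y ∈ N, y ∈ Ω ↔ 0 < heightAbove e φ y)
    {w : Space d → Space d} (hw : IntegrableOn w Ω)
    (hdiv : ∀ (ψ : Space d → ℝ) (D : ℝ≥0), LipschitzWith D ψ → HasCompactSupport ψ →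
      tsupport ψ ⊆ Ω → ∫ y in Ω, inner ℝ (w y) (∇ ψ y) = 0)
    {M : ℝ} (hM0 : 0 ≤ M) (hM : ∀ y ∈ Ω ∩ N, ‖w y‖ ≤ M)
    (hcont : ∀ y ∈ frontier Ω ∩ N, ContinuousWithinAt w (closure Ω) y)
    {ψ : Space d → ℝ} {D : ℝ≥0} (hψ : LipschitzWith D ψ) (hψs : HasCompactSupport ψ)
    (hψN : tsupport ψ ⊆ N) :
    ∫ y in Ω, inner ℝ (w y) (∇ ψ y)
      = ∫ y, ψ y * inner ℝ (w y) (outwardNormal Ω y) ∂surfaceMeasure Ω := by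
  rw [integral_surfaceMeasure_eq hΩ he hφ hN hgr
    (fun y hy => image_eq_zero_of_notMem_tsupport fun h => hy (hψN h))]
  set ε : ℕ → ℝ := fun k => 1 / ((k : ℝ) + 1) with hεdef
  have hε : ∀ k, 0 < ε k := fun k => by positivity
  have hε0 : Tendsto ε atTop (𝓝 0) := tendsto_one_div_add_atTop_nhds_zero_nat
  have hB := tendsto_integral_inner_gradient_ramp hΩ he hφ hN hgr hw.aestronglyMeasurable hM0 hM hcont
    hψ.continuous hψs hψN hε hε0
  have hhc : Continuous (heightAbove e φ) := (lipschitzWith_heightAbove he hφ).continuous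
  obtain ⟨Bψ, hBψ⟩ := hψ.continuous.bounded_above_of_compact_support hψs
  have hramp1 : ∀ k y, ‖ramp e φ (ε k) y‖ ≤ 1 := fun k y => by
    rw [Real.norm_of_nonneg (ramp_nonneg _ _)]; exact ramp_le_one _ _
  have hrc : ∀ k, Continuous (ramp e φ (ε k)) := fun k =>
    (exists_lipschitzWith_ramp he hφ (ε k)).choose_spec.continuous
  have hdom : Integrable (fun y => D * ‖w y‖) (volume.restrict Ω) := hw.norm.const_mul _
  have hAm : ∀ k, AEStronglyMeasurable (fun y => ramp e φ (ε k) y * inner ℝ (w y) (∇ ψ y))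
      (volume.restrict Ω) := fun k =>
    (hrc k).aestronglyMeasurable.mul
      (hw.aestronglyMeasurable.inner (measurable_gradient ψ).aestronglyMeasurable)
  have hAb : ∀ k y, ‖ramp e φ (ε k) y * inner ℝ (w y) (∇ ψ y)‖ ≤ D * ‖w y‖ := fun k y => by
    rw [norm_mul, mul_comm (D : ℝ)]
    refine (mul_le_mul (hramp1 k y) (norm_inner_le_norm _ _) (norm_nonneg _) zero_le_one).trans ?_
    rw [one_mul]
    exact mul_le_mul_of_nonneg_left (norm_gradient_le_of_lipschitzWith hψ y) (norm_nonneg _)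
  have hA : Tendsto (fun k => ∫ y in Ω, ramp e φ (ε k) y * inner ℝ (w y) (∇ ψ y)) atTop
      (𝓝 (∫ y in Ω, inner ℝ (w y) (∇ ψ y))) := by
    refine tendsto_integral_of_dominated_convergence (fun y => D * ‖w y‖) hAm hdom
      (fun k => Eventually.of_forall (hAb k)) ?_
    filter_upwards [ae_restrict_mem hΩ.measurableSet] with y hy
    by_cases hyN : y ∈ N
    · have hpos := (hgr y hyN).1 hy
      refine tendsto_const_nhds.congr' ?_
      filter_upwards [hε0.eventually (gt_mem_nhds (half_pos hpos))] with k hk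
      have : 2 ≤ (ε k)⁻¹ * heightAbove e φ y := by
        rw [le_inv_mul_iff₀ (hε k)]; linarith
      rw [ramp, min_eq_left (by linarith), max_eq_right zero_le_one, one_mul]
    · rw [gradient_eq_zero_of_notMem_tsupport fun h => hyN (hψN h)]
      simp
  -- The product of `ψ` and the ramp has compact support in `Ω`, so it may be used as a test function.
  have hsum : ∀ k, (∫ y in Ω, ramp e φ (ε k) y * inner ℝ (w y) (∇ ψ y))
      + ∫ y, inner ℝ (Ω.indicator (fun y => ψ y • w y) y) (∇ (ramp e φ (ε k)) y) = 0 := by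
    intro k
    obtain ⟨L, hL⟩ := exists_lipschitzWith_ramp he hφ (ε k)
    obtain ⟨L', hL'⟩ := exists_lipschitzWith_mul hψ hL hBψ (hramp1 k)
    have hsub : tsupport (fun y => ψ y * ramp e φ (ε k) y) ⊆ Ω := by
      have h1 : tsupport (fun y => ψ y * ramp e φ (ε k) y) ⊆
          tsupport ψ ∩ {y | ε k ≤ heightAbove e φ y} := by
        refine subset_inter tsupport_mul_subset_left (closure_minimal (fun y hy => ?_)
          (isClosed_le continuous_const hhc))
        by_contra hlt
        refine hy ?_
        have hlt : heightAbove e φ y < ε k := not_le.1 hlt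
        have : (ε k)⁻¹ * heightAbove e φ y ≤ 1 := by
          rw [inv_mul_le_iff₀ (hε k)]; linarith
        simp only [ramp]
        rw [max_eq_left ((min_le_right _ _).trans (by linarith)), mul_zero]
      refine h1.trans fun y hy => (hgr y (hψN hy.1)).2 ((hε k).trans_le hy.2)
    have h0 := hdiv _ L' hL' hψs.mul_right hsub
    have hIw : Integrable (fun y => inner ℝ (ψ y • w y) (∇ (ramp e φ (ε k)) y))
        (volume.restrict Ω) := by
      refine (hw.norm.const_mul (Bψ * L)).mono' ((hψ.continuous.aestronglyMeasurable.smul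
        hw.aestronglyMeasurable).inner (measurable_gradient _).aestronglyMeasurable)
        (Eventually.of_forall fun y => ?_)
      refine (norm_inner_le_norm _ _).trans ?_
      rw [norm_smul, mul_right_comm]
      exact mul_le_mul_of_nonneg_right (mul_le_mul (hBψ y)
        (norm_gradient_le_of_lipschitzWith hL y) (norm_nonneg _)
        ((norm_nonneg _).trans (hBψ y))) (norm_nonneg _)
    have hind : ∫ y, inner ℝ (Ω.indicator (fun y => ψ y • w y) y) (∇ (ramp e φ (ε k)) y)
        = ∫ y in Ω, inner ℝ (ψ y • w y) (∇ (ramp e φ (ε k)) y) := by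
      rw [← integral_indicator hΩ.measurableSet]
      refine integral_congr_ae (Eventually.of_forall fun y => ?_)
      by_cases hy : y ∈ Ω <;> simp [hy]
    rw [hind, ← integral_add (hdom.mono' (hAm k) (Eventually.of_forall (hAb k))) hIw, ← h0]
    refine integral_congr_ae (ae_restrict_of_ae ?_)
    filter_upwards [hψ.ae_differentiableAt (μ := volume), hL.ae_differentiableAt (μ := volume)]
      with y hy1 hy2
    rw [inner_gradient_mul hy1 hy2, real_inner_smul_left]
    ring
  have hlim := hA.add hB
  simp_rw [hsum] at hlim
  have := tendsto_nhds_unique tendsto_const_nhds hlim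
  linarith

end Local

end BarusFlow

/-! ### Cutoff functions for sets of finite codimension-two measure -/

namespace BarusFlow

open Metric
open scoped ENNReal NNReal

section Capacity

variable {d : ℕ} {S : Set (Space d)}

/-- Compact sets of finite `(d-2)`-dimensional Hausdorff measure have coverings by finitely many
balls of radii `rₙ < δ` with `∑ rₙ ^ (d - 2)` bounded independently of `δ`. -/
theorem exists_ball_cover (hS : IsCompact S)
    (hfin : Measure.hausdorffMeasure ((d : ℝ) - 2) S < ⊤) :
    ∃ C : ℝ, ∀ δ : ℝ, 0 < δ → ∃ (t : Finset ℕ) (x : ℕ → Space d) (r : ℕ → ℝ),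
      (∀ n ∈ t, x n ∈ S ∧ 0 < r n ∧ r n < δ) ∧ (S ⊆ ⋃ n ∈ t, ball (x n) (r n)) ∧
      ∑ n ∈ t, r n ^ d * (r n)⁻¹ ^ 2 ≤ C := by
  set H := Measure.hausdorffMeasure ((d : ℝ) - 2) S with hH
  refine ⟨(H + 2).toReal, fun δ hδ => ?_⟩
  have hlt : (⨅ (t : ℕ → Set (Space d)) (_ : S ⊆ ⋃ n, t n)
      (_ : ∀ n, ediam (t n) ≤ ENNReal.ofReal (δ / 2)),
        ∑' n, ⨆ _ : (t n).Nonempty, ediam (t n) ^ ((d : ℝ) - 2)) < H + 1 := by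
    refine lt_of_le_of_lt ?_ (ENNReal.lt_add_right hfin.ne one_ne_zero)
    rw [hH, Measure.hausdorffMeasure_apply]
    exact le_iSup₂_of_le (ENNReal.ofReal (δ / 2)) (by simpa using hδ) le_rfl
  simp only [iInf_lt_iff] at hlt
  obtain ⟨T, hcov, hdiam, hsum⟩ := hlt
  obtain ⟨ε, hε, hεsum⟩ := ENNReal.exists_pos_sum_of_countable' (one_ne_zero (α := ℝ≥0∞)) ℕ
  -- Radii slightly larger than the diameters increase the sum by less than one.
  have hr : ∀ n, ∃ ρ : ℝ, 0 < ρ ∧ ρ < δ ∧ ediam (T n) < ENNReal.ofReal ρ ∧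
      ENNReal.ofReal ρ ^ ((d : ℝ) - 2) ≤ ediam (T n) ^ ((d : ℝ) - 2) + ε n := by
    intro n
    have hfinite : ediam (T n) ≠ ⊤ := ((hdiam n).trans_lt ENNReal.ofReal_lt_top).ne
    set a := (ediam (T n)).toReal with ha
    have ha0 : 0 ≤ a := ENNReal.toReal_nonneg
    have haδ : a < δ := by
      have := ENNReal.toReal_le_of_le_ofReal (by positivity) (hdiam n)
      linarith
    have haeq : ENNReal.ofReal a = ediam (T n) := ENNReal.ofReal_toReal hfinite
    have hev : ∀ᶠ ρ in 𝓝[>] a,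
        ENNReal.ofReal ρ ^ ((d : ℝ) - 2) ≤ ediam (T n) ^ ((d : ℝ) - 2) + ε n := by
      by_cases htop : ediam (T n) ^ ((d : ℝ) - 2) = ⊤
      · simp [htop]
      · have hc : Continuous fun ρ : ℝ => ENNReal.ofReal ρ ^ ((d : ℝ) - 2) :=
          ENNReal.continuous_rpow_const.comp ENNReal.continuous_ofReal
        have hlt : ENNReal.ofReal a ^ ((d : ℝ) - 2) < ediam (T n) ^ ((d : ℝ) - 2) + ε n := by
          rw [haeq]
          exact ENNReal.lt_add_right htop (hε n).ne'
        have := (hc.tendsto a).eventually_lt_const hlt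
        exact (this.filter_mono nhdsWithin_le_nhds).mono fun _ h => h.le
    obtain ⟨ρ, h1, h2⟩ := (hev.and (Ioo_mem_nhdsGT haδ)).exists
    refine ⟨ρ, ha0.trans_lt h2.1, h2.2, ?_, h1⟩
    rw [← haeq]
    exact (ENNReal.ofReal_lt_ofReal_iff (ha0.trans_lt h2.1)).2 h2.1
  choose r hr0 hrδ hrdiam hrsum using hr
  have hx : ∀ n, ∃ x, (T n ∩ S).Nonempty → x ∈ T n ∩ S := fun n => by
    by_cases h : (T n ∩ S).Nonempty
    · exact ⟨h.some, fun _ => h.some_mem⟩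
    · exact ⟨0, fun h' => absurd h' h⟩
  choose x hx using hx
  obtain ⟨b, hbI, hbf, hbcov⟩ := hS.elim_finite_subcover_image (b := {n | (T n ∩ S).Nonempty})
    (c := fun n => ball (x n) (r n)) (fun n _ => isOpen_ball) (fun y hy => by
      obtain ⟨n, hn⟩ := mem_iUnion.1 (hcov hy)
      have hne : (T n ∩ S).Nonempty := ⟨y, hn, hy⟩
      refine mem_iUnion₂.2 ⟨n, hne, ?_⟩
      have h1 := (edist_le_ediam_of_mem hn (hx n hne).1).trans_lt (hrdiam n)
      rw [edist_dist] at h1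
      exact (ENNReal.ofReal_lt_ofReal_iff (hr0 n)).1 h1)
  refine ⟨hbf.toFinset, x, r, fun n hn => ?_, ?_, ?_⟩
  · exact ⟨(hx n (hbI (hbf.mem_toFinset.1 hn))).2, hr0 n, hrδ n⟩
  · simpa using hbcov
  have hterm : ∀ n, ENNReal.ofReal (r n ^ d * (r n)⁻¹ ^ 2) = ENNReal.ofReal (r n) ^ ((d : ℝ) - 2) :=
    fun n => by
      rw [ENNReal.ofReal_rpow_of_pos (hr0 n), Real.rpow_sub (hr0 n), Real.rpow_natCast,
        div_eq_mul_inv, inv_pow]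
      norm_num
  have hpos : ∀ n, 0 ≤ r n ^ d * (r n)⁻¹ ^ 2 := fun n => by have := (hr0 n).le; positivity
  rw [← ENNReal.ofReal_le_iff_le_toReal (by finiteness),
    ENNReal.ofReal_sum_of_nonneg fun n _ => hpos n]
  calc ∑ n ∈ hbf.toFinset, ENNReal.ofReal (r n ^ d * (r n)⁻¹ ^ 2)
      ≤ ∑ n ∈ hbf.toFinset,
          ((⨆ _ : (T n).Nonempty, ediam (T n) ^ ((d : ℝ) - 2)) + ε n) := by
        refine Finset.sum_le_sum fun n hn => ?_
        have hne : (T n).Nonempty := (hbI (hbf.mem_toFinset.1 hn)).mono inter_subset_left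
        rw [hterm, ciSup_pos hne]
        exact hrsum n
    _ ≤ ∑' n, ((⨆ _ : (T n).Nonempty, ediam (T n) ^ ((d : ℝ) - 2)) + ε n) :=
        ENNReal.sum_le_tsum _
    _ ≤ H + 2 := by
        rw [ENNReal.tsum_add, show H + 2 = (H + 1) + 1 by rw [add_assoc, one_add_one_eq_two]]
        exact add_le_add hsum.le hεsum.le

/-- The cutoff which is `1` on the ball of radius `r` about `x` and `0` off the ball of radius
`2 r`. -/
noncomputable def ballCutoff (x : Space d) (r : ℝ) (y : Space d) : ℝ :=
  max 0 (min 1 (2 - r⁻¹ * dist y x))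

theorem lipschitzWith_ballCutoff (x : Space d) {r : ℝ} (hr : 0 < r) :
    LipschitzWith (Real.toNNReal r⁻¹) (ballCutoff x r) := by
  have h : LipschitzWith (Real.toNNReal r⁻¹) fun y : Space d => 2 - r⁻¹ * dist y x := by
    refine LipschitzWith.of_dist_le' fun y z => ?_
    rw [Real.dist_eq, show 2 - r⁻¹ * dist y x - (2 - r⁻¹ * dist z x)
      = r⁻¹ * (dist z x - dist y x) by ring, abs_mul, abs_of_pos (inv_pos.2 hr)]
    refine mul_le_mul_of_nonneg_left ?_ (inv_pos.2 hr).le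
    rw [dist_comm y z]
    exact abs_dist_sub_le z y x
  exact (h.const_min 1).const_max 0

theorem norm_gradient_ballCutoff_sq_le (x : Space d) {r : ℝ} (hr : 0 < r) (y : Space d) :
    ‖∇ (ballCutoff x r) y‖ ^ 2
      ≤ (closedBall x (2 * r)).indicator (fun _ => (r⁻¹) ^ 2) y := by
  by_cases hy : y ∈ closedBall x (2 * r)
  · rw [indicator_of_mem hy]
    have := norm_gradient_le_of_lipschitzWith (lipschitzWith_ballCutoff x hr) y
    rw [Real.coe_toNNReal _ (inv_pos.2 hr).le] at this
    gcongr
  · rw [gradient_eq_zero_of_notMem_tsupport fun h => hy ?_]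
    · exact (by simp : ‖(0 : Space d)‖ ^ 2 = 0).trans_le (indicator_nonneg (fun _ _ => by positivity) _)
    · refine closure_minimal (fun z hz => ?_) isClosed_closedBall h
      by_contra hzn
      refine hz ?_
      have : 2 ≤ r⁻¹ * dist z x := by
        rw [le_inv_mul_iff₀ hr]
        rw [mem_closedBall, not_le] at hzn
        linarith
      rw [ballCutoff, max_eq_left]
      exact (min_le_right _ _).trans (by linarith)

/-- The gradient of a maximum is one of the two gradients. -/
theorem norm_gradient_max_sq_le {f g : Space d → ℝ} {x : Space d} (hf : DifferentiableAt ℝ f x)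
    (hg : DifferentiableAt ℝ g x) (hfg : DifferentiableAt ℝ (fun y => max (f y) (g y)) x) :
    ‖∇ (fun y => max (f y) (g y)) x‖ ^ 2 ≤ ‖∇ f x‖ ^ 2 + ‖∇ g x‖ ^ 2 := by
  -- Where the maximum agrees with `f`, its difference with `f` is minimal.
  have key : ∀ {h : Space d → ℝ}, DifferentiableAt ℝ h x → (∀ y, h y ≤ max (f y) (g y)) →
      max (f x) (g x) = h x → ∇ (fun y => max (f y) (g y)) x = ∇ h x := by
    intro h hh hle heq
    have hmin : IsLocalMin (fun y => max (f y) (g y) - h y) x :=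
      Eventually.of_forall fun y => by
        simpa only [heq, sub_self] using sub_nonneg.2 (hle y)
    have := hmin.fderiv_eq_zero
    rw [fderiv_fun_sub hfg hh, sub_eq_zero] at this
    rw [gradient, gradient, this]
  rcases le_total (g x) (f x) with h | h
  · rw [key hf (fun y => le_max_left _ _) (max_eq_left h)]
    linarith [sq_nonneg ‖∇ g x‖]
  · rw [key hg (fun y => le_max_right _ _) (max_eq_right h)]
    linarith [sq_nonneg ‖∇ f x‖]

/-- Cutoff functions of finite unions of balls. -/
theorem exists_cutoff_of_balls (t : Finset ℕ) (x : ℕ → Space d) (r : ℕ → ℝ)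
    (hr : ∀ n ∈ t, 0 < r n) :
    ∃ θ : Space d → ℝ, (∃ L, LipschitzWith L θ) ∧ (∀ y, 0 ≤ θ y) ∧ (∀ y, θ y ≤ 1) ∧
      (∀ n ∈ t, ∀ y ∈ ball (x n) (r n), θ y = 1) ∧
      (∀ y, (∀ n ∈ t, 2 * r n ≤ dist y (x n)) → θ y = 0) ∧
      ∀ᵐ y, ‖∇ θ y‖ ^ 2 ≤
        ∑ n ∈ t, (closedBall (x n) (2 * r n)).indicator (fun _ => (r n)⁻¹ ^ 2) y := by
  induction t using Finset.induction_on with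
  | empty =>
    refine ⟨fun _ => 0, ⟨0, LipschitzWith.const 0⟩, by simp, by simp, by simp, by simp,
      .of_forall fun y => ?_⟩
    simp
  | insert a t ha ih =>
    obtain ⟨θ, ⟨L, hL⟩, h0, h1, hball, hoff, hgrad⟩ := ih fun n hn =>
      hr n (Finset.mem_insert_of_mem hn)
    have hra := hr a (Finset.mem_insert_self _ _)
    have hLa := lipschitzWith_ballCutoff (x a) hra
    have hmax := hLa.max hL
    have ha1 : ∀ y, ballCutoff (x a) (r a) y ≤ 1 := fun y =>
      max_le zero_le_one (min_le_left _ _)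
    refine ⟨fun y => max (ballCutoff (x a) (r a) y) (θ y), ⟨_, hmax⟩,
      fun y => le_max_of_le_right (h0 y), fun y => max_le (ha1 y) (h1 y), ?_, ?_, ?_⟩
    · intro n hn y hy
      rcases Finset.mem_insert.1 hn with rfl | hn
      · have : (r n)⁻¹ * dist y (x n) ≤ 1 := by
          rw [inv_mul_le_iff₀ hra]
          rw [mem_ball] at hy
          linarith
        have h2 : ballCutoff (x n) (r n) y = 1 := by
          rw [ballCutoff, min_eq_left (by linarith), max_eq_right zero_le_one]
        simp only [h2]
        exact max_eq_left (h1 y)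
      · simp only [hball n hn y hy]
        exact max_eq_right (ha1 y)
    · intro y hy
      have h2 : 2 ≤ (r a)⁻¹ * dist y (x a) := by
        rw [le_inv_mul_iff₀ hra]
        linarith [hy a (Finset.mem_insert_self _ _)]
      have h3 : ballCutoff (x a) (r a) y = 0 :=
        max_eq_left ((min_le_right _ _).trans (by linarith))
      simp only [h3, hoff y fun n hn => hy n (Finset.mem_insert_of_mem hn), max_self]
    · filter_upwards [hgrad, hL.ae_differentiableAt (μ := volume),
        hLa.ae_differentiableAt (μ := volume), hmax.ae_differentiableAt (μ := volume)]
        with y hy d1 d2 d3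
      rw [Finset.sum_insert ha]
      exact (norm_gradient_max_sq_le d2 d1 d3).trans
        (add_le_add (norm_gradient_ballCutoff_sq_le _ hra y) hy)

/-- A compact set of finite `(d-2)`-dimensional Hausdorff measure has cutoff functions concentrated
in arbitrarily small neighbourhoods, with bounded Dirichlet integrals. -/
theorem exists_cutoff (hS : IsCompact S)
    (hfin : Measure.hausdorffMeasure ((d : ℝ) - 2) S < ⊤) :
    ∃ C : ℝ, ∀ δ : ℝ, 0 < δ → ∃ θ : Space d → ℝ, (∃ L, LipschitzWith L θ) ∧
      (∀ y, 0 ≤ θ y) ∧ (∀ y, θ y ≤ 1) ∧ (∃ V, IsOpen V ∧ S ⊆ V ∧ ∀ y ∈ V, θ y = 1) ∧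
      (∀ y, y ∉ cthickening δ S → θ y = 0) ∧
      ∫ y, ‖∇ θ y‖ ^ 2 ≤ C := by
  obtain ⟨C, hC⟩ := exists_ball_cover hS hfin
  set c : ℝ := (volume (ball (0 : Space d) 1)).toReal with hc
  refine ⟨2 ^ d * c * C, fun δ hδ => ?_⟩
  obtain ⟨t, x, r, htr, hcov, hsum⟩ := hC (δ / 2) (half_pos hδ)
  obtain ⟨θ, hL, h0, h1, hball, hoff, hgrad⟩ := exists_cutoff_of_balls t x r fun n hn =>
    (htr n hn).2.1
  refine ⟨θ, hL, h0, h1, ⟨⋃ n ∈ t, ball (x n) (r n), isOpen_biUnion fun _ _ => isOpen_ball, hcov,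
    fun y hy => ?_⟩, fun y hy => hoff y fun n hn => ?_, ?_⟩
  · obtain ⟨n, hn, hy⟩ := mem_iUnion₂.1 hy
    exact hball n hn y hy
  · by_contra! hlt
    obtain ⟨hxS, _, hrδ⟩ := htr n hn
    exact hy (mem_cthickening_of_dist_le y (x n) δ S hxS (by linarith))
  have hint : ∀ n ∈ t, Integrable
      ((closedBall (x n) (2 * r n)).indicator fun _ => (r n)⁻¹ ^ 2) volume := fun n _ =>
    (integrableOn_const (isCompact_closedBall _ _).measure_lt_top.ne).integrable_indicator
      isClosed_closedBall.measurableSet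
  refine (integral_mono_of_nonneg (.of_forall fun y => sq_nonneg _)
    (integrable_finsetSum t hint) hgrad).trans ?_
  rw [integral_finsetSum t hint]
  calc ∑ n ∈ t, ∫ y, (closedBall (x n) (2 * r n)).indicator (fun _ => (r n)⁻¹ ^ 2) y
      = ∑ n ∈ t, 2 ^ d * c * (r n ^ d * (r n)⁻¹ ^ 2) := by
        refine Finset.sum_congr rfl fun n hn => ?_
        have hrn := (htr n hn).2.1
        rw [integral_indicator isClosed_closedBall.measurableSet, setIntegral_const, smul_eq_mul,
          Measure.real, Measure.addHaar_closedBall _ _ (by positivity), ENNReal.toReal_mul,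
          ENNReal.toReal_ofReal (by positivity), finrank_euclideanSpace_fin, ← hc]
        ring
    _ = 2 ^ d * c * ∑ n ∈ t, r n ^ d * (r n)⁻¹ ^ 2 := by rw [Finset.mul_sum]
    _ ≤ 2 ^ d * c * C := by gcongr

end Capacity

end BarusFlow

/-! ### The divergence theorem off the exceptional set -/

namespace BarusFlow

open Metric
open scoped ENNReal NNReal Manifold

section Global

variable {d : ℕ} {Ω S : Set (Space d)} {w : Space d → Space d}

/-- Passage from local to global in the divergence theorem, by a partition of unity. -/
theorem setIntegral_inner_gradient_eq_of_local (hΩ : IsOpen Ω) (hΩb : Bornology.IsBounded Ω)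
    (hw : IntegrableOn w Ω) {h : Space d → ℝ} (hh : Integrable h (surfaceMeasure Ω))
    {η : Space d → ℝ} {L : ℝ≥0} (hη : LipschitzWith L η) {A : ℝ} (hA : ∀ y, ‖η y‖ ≤ A)
    (hloc : ∀ x ∈ closure Ω, ∃ U, IsOpen U ∧ x ∈ U ∧ ∀ (ψ : Space d → ℝ) (D : ℝ≥0),
      LipschitzWith D ψ → HasCompactSupport ψ → tsupport ψ ⊆ U →
      ∫ y in Ω, inner ℝ (w y) (∇ (fun y => ψ y * η y) y)
        = ∫ y, ψ y * η y * h y ∂surfaceMeasure Ω) :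
    ∫ y in Ω, inner ℝ (w y) (∇ η y) = ∫ y, η y * h y ∂surfaceMeasure Ω := by
  choose! U hU hxU hid using hloc
  have hK : IsCompact (closure Ω) := hΩb.isCompact_closure
  obtain ⟨t, ht, hcov⟩ := hK.elim_nhds_subcover (fun x => U x ∩ ball x 1) fun x hx =>
    ((hU x hx).inter isOpen_ball).mem_nhds ⟨hxU x hx, mem_ball_self one_pos⟩
  obtain ⟨ζ, hζ⟩ := SmoothPartitionOfUnity.exists_isSubordinate 𝓘(ℝ, Space d) isClosed_closure
    (fun i : t => U i ∩ ball (i : Space d) 1) (fun i => (hU i (ht i i.2)).inter isOpen_ball)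
    (fun y hy => by
      obtain ⟨i, hi, hy⟩ := mem_iUnion₂.1 (hcov hy)
      exact mem_iUnion.2 ⟨⟨i, hi⟩, hy⟩)
  have hζs : ∀ i, HasCompactSupport (ζ i) := fun i =>
    isCompact_of_isClosed_isBounded (isClosed_tsupport _)
      (isBounded_ball.subset ((hζ i).trans inter_subset_right))
  have hζd : ∀ i, ContDiff ℝ ∞ (ζ i) := fun i => (ζ i).contMDiff.contDiff
  have hζL : ∀ i, ∃ D, LipschitzWith D (ζ i) := fun i =>
    ((hζd i).of_le (by norm_num)).lipschitzWith_of_hasCompactSupport (hζs i) one_ne_zero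
  choose D hD using hζL
  have hζB : ∀ i, ∃ B, ∀ y, ‖ζ i y‖ ≤ B := fun i =>
    (hζd i).continuous.bounded_above_of_compact_support (hζs i)
  choose B hB using hζB
  have hprod : ∀ i, ∃ L', LipschitzWith L' fun y => ζ i y * η y := fun i =>
    exists_lipschitzWith_mul (hD i) hη (hB i) hA
  choose L' hL' using hprod
  have hsum1 : ∀ y ∈ closure Ω, ∑ i, ζ i y * η y = η y := fun y hy => by
    have := ζ.sum_eq_one hy
    rw [finsum_eq_sum_of_fintype] at this
    rw [← Finset.sum_mul, this, one_mul]
  have hI : ∀ i, IntegrableOn (fun y => inner ℝ (w y) (∇ (fun y => ζ i y * η y) y)) Ω := fun i => by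
    refine (hw.norm.mul_const (L' i : ℝ)).mono' (hw.aestronglyMeasurable.inner
      (measurable_gradient _).aestronglyMeasurable) (.of_forall fun y => ?_)
    exact (norm_inner_le_norm _ _).trans (mul_le_mul_of_nonneg_left
      (norm_gradient_le_of_lipschitzWith (hL' i) y) (norm_nonneg _))
  have hJ : ∀ i, Integrable (fun y => ζ i y * η y * h y) (surfaceMeasure Ω) := fun i => by
    refine hh.bdd_mul (hL' i).continuous.aestronglyMeasurable
      (c := B i * A) (.of_forall fun y => ?_)
    rw [norm_mul]
    exact mul_le_mul (hB i y) (hA y) (norm_nonneg _) ((norm_nonneg _).trans (hB i y))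
  have hleft : ∫ y in Ω, inner ℝ (w y) (∇ η y)
      = ∑ i, ∫ y in Ω, inner ℝ (w y) (∇ (fun y => ζ i y * η y) y) := by
    rw [← integral_finsetSum _ fun i _ => hI i]
    refine integral_congr_ae ?_
    filter_upwards [ae_restrict_mem hΩ.measurableSet,
      ae_restrict_of_ae (ae_all_iff.2 fun i => (hL' i).ae_differentiableAt (μ := volume))]
      with y hy hdiff
    have heq : η =ᶠ[𝓝 y] fun z => ∑ i, ζ i z * η z := by
      filter_upwards [hΩ.mem_nhds hy] with z hz using (hsum1 z (subset_closure hz)).symm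
    simp_rw [inner_gradient_eq_fderiv]
    rw [heq.fderiv_eq, fderiv_fun_sum fun i _ => hdiff i]
    simp
  have hright : ∫ y, η y * h y ∂surfaceMeasure Ω
      = ∑ i, ∫ y, ζ i y * η y * h y ∂surfaceMeasure Ω := by
    rw [← integral_finsetSum _ fun i _ => hJ i]
    refine integral_congr_ae ?_
    filter_upwards [ae_restrict_mem isClosed_frontier.measurableSet] with y hy
    rw [← Finset.sum_mul, hsum1 y (frontier_subset_closure hy)]
  rw [hleft, hright]
  exact Finset.sum_congr rfl fun i _ => hid i (ht i i.2) _ _ (hD i) (hζs i)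
    ((hζ i).trans inter_subset_left)

/-- The divergence theorem for a divergence-free field which is continuous up to the boundary off
a closed set `S`, with weights vanishing near `S`. -/
theorem setIntegral_inner_gradient_eq_surface_of_eq_zero (hΩ : IsBoundedLipschitzDomain Ω)
    (hSc : IsClosed S) (hw : IntegrableOn w Ω)
    (hdiv : ∀ (ψ : Space d → ℝ) (D : ℝ≥0), LipschitzWith D ψ → HasCompactSupport ψ →
      tsupport ψ ⊆ Ω → ∫ y in Ω, inner ℝ (w y) (∇ ψ y) = 0)
    (hcont : ∀ y ∈ frontier Ω \ S, ContinuousWithinAt w (closure Ω) y)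
    (hflux : Integrable (fun y => inner ℝ (w y) (outwardNormal Ω y)) (surfaceMeasure Ω))
    {η : Space d → ℝ} {L : ℝ≥0} (hη : LipschitzWith L η) {A : ℝ} (hA : ∀ y, ‖η y‖ ≤ A)
    {V : Set (Space d)} (hV : IsOpen V) (hSV : S ⊆ V) (hηV : ∀ y ∈ V, η y = 0) :
    ∫ y in Ω, inner ℝ (w y) (∇ η y)
      = ∫ y, η y * inner ℝ (w y) (outwardNormal Ω y) ∂surfaceMeasure Ω := by
  refine setIntegral_inner_gradient_eq_of_local hΩ.isOpen hΩ.isBounded hw hflux hη hA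
    fun x hx => ?_
  by_cases hxΩ : x ∈ Ω
  · refine ⟨Ω, hΩ.isOpen, hxΩ, fun ψ D hψ hψs hψΩ => ?_⟩
    obtain ⟨B, hB⟩ := hψ.continuous.bounded_above_of_compact_support hψs
    obtain ⟨L', hL'⟩ := exists_lipschitzWith_mul hψ hη hB hA
    rw [hdiv _ L' hL' hψs.mul_right (tsupport_mul_subset_left.trans hψΩ)]
    refine (setIntegral_eq_zero_of_forall_eq_zero fun y hy => ?_).symm
    rw [hΩ.isOpen.frontier_eq] at hy
    rw [image_eq_zero_of_notMem_tsupport fun h => hy.2 (hψΩ h), zero_mul, zero_mul]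
  have hxf : x ∈ frontier Ω := by
    rw [hΩ.isOpen.frontier_eq]; exact ⟨hx, hxΩ⟩
  by_cases hxS : x ∈ S
  · refine ⟨V, hV, hSV hxS, fun ψ D hψ hψs hψV => ?_⟩
    have h0 : ∀ y, ψ y * η y = 0 := fun y => by
      by_cases hy : y ∈ V
      · rw [hηV y hy, mul_zero]
      · rw [image_eq_zero_of_notMem_tsupport fun h => hy (hψV h), zero_mul]
    simp [h0]
  obtain ⟨e, he, φ, ⟨C, hφ⟩, U, hU, hgr⟩ := hΩ.lipschitz x hxf
  have hbd : ∀ᶠ y in 𝓝 x, y ∈ closure Ω → ‖w y‖ ≤ ‖w x‖ + 1 := by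
    have := (hcont x ⟨hxf, hxS⟩).norm.eventually_lt_const (lt_add_one ‖w x‖)
    exact (eventually_nhdsWithin_iff.1 this).mono fun y hy h => (hy h).le
  obtain ⟨N, hN, hNo, hxN⟩ := _root_.eventually_nhds_iff.1
    ((hbd.and hU).and (hSc.isOpen_compl.mem_nhds hxS))
  refine ⟨N, hNo, hxN, fun ψ D hψ hψs hψN => ?_⟩
  obtain ⟨B, hB⟩ := hψ.continuous.bounded_above_of_compact_support hψs
  obtain ⟨L', hL'⟩ := exists_lipschitzWith_mul hψ hη hB hA
  refine setIntegral_inner_gradient_eq_surface hΩ.isOpen he hφ hNo (fun y hy => ?_) hw hdiv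
    (M := ‖w x‖ + 1) (by positivity) (fun y hy => (hN y hy.2).1.1 (subset_closure hy.1))
    (fun y hy => hcont y ⟨hy.1, (hN y hy.2).2⟩) hL' hψs.mul_right
    (tsupport_mul_subset_left.trans hψN)
  rw [hgr y (hN y hy).1.2, heightAbove, sub_pos]

theorem surfaceMeasure_eq_zero_of_hausdorffMeasure_lt_top (hSΩ : S ⊆ frontier Ω)
    (hfin : Measure.hausdorffMeasure ((d : ℝ) - 2) S < ⊤) : surfaceMeasure Ω S = 0 := by
  rcases d with _ | d
  · have : S = ∅ := by
      refine subset_empty_iff.1 (hSΩ.trans ?_)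
      rw [(isClopen_discrete Ω).frontier_eq]
    simp [this]
  · refine Measure.restrict_apply_le _ _ |>.trans_eq ?_ |> le_antisymm <| bot_le
    have h : ((d + 1 : ℕ) : ℝ) - 2 < ((d + 1 - 1 : ℕ) : ℝ) := by
      push_cast [Nat.add_sub_cancel]; linarith
    rw [Measure.euclideanHausdorffMeasure_def, Measure.smul_apply,
      (Measure.hausdorffMeasure_zero_or_top h S).resolve_right hfin.ne, smul_zero]

theorem eventually_notMem_cthickening_one_div (hSc : IsClosed S) {y : Space d} (hy : y ∉ S) :
    ∀ᶠ k : ℕ in atTop, y ∉ cthickening (1 / ((k : ℝ) + 1)) S := by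
  obtain ⟨ε, hε, hball⟩ := Metric.isOpen_iff.1 hSc.isOpen_compl y hy
  filter_upwards [tendsto_one_div_add_atTop_nhds_zero_nat.eventually_lt_const (half_pos hε)]
    with k hk hmem
  obtain ⟨z, hzS, hz⟩ := mem_thickening_iff.1
    (cthickening_subset_thickening' hε (by linarith) S hmem)
  exact hball (by rwa [mem_ball, dist_comm]) hzS

/-- The total flux of a square-integrable divergence-free field through the boundary vanishes. The
cutoffs near the exceptional set `S` have bounded Dirichlet integrals, while the energy of the field
near `S` is small. -/
theorem integral_flux_eq_zero (hΩ : IsBoundedLipschitzDomain Ω)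
    (hSc : IsClosed S) (hSΩ : S ⊆ frontier Ω)
    (hfin : Measure.hausdorffMeasure ((d : ℝ) - 2) S < ⊤)
    (hw : MemLp w 2 (volume.restrict Ω))
    (hdiv : ∀ φ, IsTestFunction Ω φ → ∫ x in Ω, inner ℝ (w x) (∇ φ x) = 0)
    (hcont : ∀ y ∈ frontier Ω \ S, ContinuousWithinAt w (closure Ω) y)
    (hflux : Integrable (fun y => inner ℝ (w y) (outwardNormal Ω y)) (surfaceMeasure Ω)) :
    ∫ y, inner ℝ (w y) (outwardNormal Ω y) ∂surfaceMeasure Ω = 0 := by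
  have hΩm := hΩ.isOpen.measurableSet
  have hΩfin : IsFiniteMeasure (volume.restrict Ω) :=
    isFiniteMeasure_restrict.2 hΩ.isBounded.measure_lt_top.ne
  have hwi : IntegrableOn w Ω := hw.integrable one_le_two
  have hw2 : Integrable (fun y => ‖w y‖ ^ 2) (volume.restrict Ω) := hw.integrable_norm_pow two_ne_zero
  have hdivL : ∀ (ψ : Space d → ℝ) (D : ℝ≥0), LipschitzWith D ψ → HasCompactSupport ψ →
      tsupport ψ ⊆ Ω → ∫ y in Ω, inner ℝ (w y) (∇ ψ y) = 0 := by
    have hind : ∀ ψ : Space d → ℝ, ∫ y in Ω, inner ℝ (w y) (∇ ψ y)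
        = ∫ y, inner ℝ (Ω.indicator w y) (∇ ψ y) := fun ψ => by
      rw [← integral_indicator hΩm]
      refine integral_congr_ae (.of_forall fun y => ?_)
      by_cases hy : y ∈ Ω <;> simp [hy]
    intro ψ D hψ hψs hψΩ
    rw [hind]
    exact integral_inner_gradient_eq_zero_of_lipschitz hΩ.isOpen
      ((integrable_indicator_iff hΩm).2 hwi).locallyIntegrable
      (fun φ hφ => (hind φ).symm.trans (hdiv φ hφ)) hψ hψs hψΩ
  have hS : IsCompact S := isCompact_of_isClosed_isBounded hSc
    (hΩ.isBounded.closure.subset (hSΩ.trans frontier_subset_closure))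
  obtain ⟨C, hC⟩ := exists_cutoff hS hfin
  set δ : ℕ → ℝ := fun k => 1 / ((k : ℝ) + 1) with hδ
  choose θ hθL h0 h1 hV hoff hdir using fun k => hC (δ k) (by positivity)
  choose L hL using hθL
  choose V hVo hSV hV1 using hV
  set h : Space d → ℝ := fun y => inner ℝ (w y) (outwardNormal Ω y) with hh
  have hηL : ∀ k, LipschitzWith (0 + L k) fun y => 1 - θ k y := fun k =>
    (LipschitzWith.const 1).sub (hL k)
  have hη1 : ∀ k y, ‖1 - θ k y‖ ≤ 1 := fun k y => by
    rw [Real.norm_eq_abs, abs_le]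
    constructor <;> linarith [h0 k y, h1 k y]
  have hgg : ∀ k, ∫ y in Ω, inner ℝ (w y) (∇ (fun y => 1 - θ k y) y)
      = ∫ y, (1 - θ k y) * h y ∂surfaceMeasure Ω := fun k =>
    setIntegral_inner_gradient_eq_surface_of_eq_zero hΩ hSc hwi hdivL hcont hflux (hηL k)
      (hη1 k) (hVo k) (hSV k) fun y hy => by rw [hV1 k y hy, sub_self]
  have hlim : Tendsto (fun k => ∫ y, (1 - θ k y) * h y ∂surfaceMeasure Ω) atTop
      (𝓝 (∫ y, h y ∂surfaceMeasure Ω)) := by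
    refine tendsto_integral_of_dominated_convergence (fun y => ‖h y‖)
      (fun k => (hηL k).continuous.aestronglyMeasurable.mul hflux.aestronglyMeasurable) hflux.norm
      (fun k => .of_forall fun y => ?_) ?_
    · rw [norm_mul]
      exact mul_le_of_le_one_left (norm_nonneg _) (hη1 k y)
    · have hSn : ∀ᵐ y ∂surfaceMeasure Ω, y ∉ S :=
        measure_eq_zero_iff_ae_notMem.1 (surfaceMeasure_eq_zero_of_hausdorffMeasure_lt_top hSΩ hfin)
      filter_upwards [hSn] with y hy
      refine tendsto_const_nhds.congr' ?_
      filter_upwards [eventually_notMem_cthickening_one_div hSc hy] with k hk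
      rw [hoff k y hk, sub_zero, one_mul]
  set T : ℕ → Set (Space d) := fun k => cthickening (δ k) S with hT
  have hTm : ∀ k, MeasurableSet (T k) := fun k => isClosed_cthickening.measurableSet
  have hsmall : Tendsto (fun k => ∫ y in Ω, (T k).indicator (fun y => ‖w y‖ ^ 2) y) atTop
      (𝓝 0) := by
    have h00 : ∫ y in Ω, (0 : ℝ) = 0 := by simp
    rw [← h00]
    refine tendsto_integral_of_dominated_convergence (fun y => ‖w y‖ ^ 2)
      (fun k => hw2.aestronglyMeasurable.indicator (hTm k)) hw2
      (fun k => .of_forall fun y => ?_) ?_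
    · refine (norm_indicator_le_norm_self _ _).trans_eq ?_
      rw [Real.norm_of_nonneg (sq_nonneg _)]
    · filter_upwards [ae_restrict_mem hΩm] with y hy
      have hyS : y ∉ S := fun hS' => by
        have := hSΩ hS'
        rw [hΩ.isOpen.frontier_eq] at this
        exact this.2 hy
      refine tendsto_const_nhds.congr' ?_
      filter_upwards [eventually_notMem_cthickening_one_div hSc hyS] with k hk
      rw [indicator_of_notMem hk]
  have hgrad0 : ∀ k y, y ∉ T k → ∇ (θ k) y = 0 := fun k y hy =>
    gradient_eq_zero_of_notMem_tsupport fun hm => hy <|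
      closure_minimal (show Function.support (θ k) ⊆ T k from fun z hz =>
        by_contra fun hzT => hz (hoff k z hzT)) isClosed_cthickening hm
  have hg2 : ∀ k, Integrable (fun y => ‖∇ (θ k) y‖ ^ 2) volume := fun k => by
    have hb : Integrable ((T k).indicator fun _ => (L k : ℝ) ^ 2) volume :=
      (integrableOn_const hS.cthickening.measure_lt_top.ne).integrable_indicator (hTm k)
    refine hb.mono' ((measurable_gradient _).norm.pow_const 2).aestronglyMeasurable
      (.of_forall fun y => ?_)
    rw [norm_pow, norm_norm]
    by_cases hy : y ∈ T k
    · rw [indicator_of_mem hy]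
      have := norm_gradient_le_of_lipschitzWith (hL k) y
      gcongr
    · rw [hgrad0 k y hy, indicator_of_notMem hy]
      simp
  -- Young's inequality on the support of the gradient of the cutoff.
  have hbound : ∀ ε : ℝ, 0 < ε → ∀ k, |∫ y, (1 - θ k y) * h y ∂surfaceMeasure Ω|
      ≤ ε⁻¹ * (∫ y in Ω, (T k).indicator (fun y => ‖w y‖ ^ 2) y) + ε * C := by
    intro ε hε k
    rw [← hgg k, ← Real.norm_eq_abs]
    have hi1 : Integrable (fun y => ε⁻¹ * (T k).indicator (fun y => ‖w y‖ ^ 2) y)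
        (volume.restrict Ω) := (hw2.indicator (hTm k)).const_mul _
    have hi2 : Integrable (fun y => ε * ‖∇ (θ k) y‖ ^ 2) (volume.restrict Ω) :=
      ((hg2 k).const_mul ε).integrableOn
    refine (norm_integral_le_of_norm_le (hi1.add hi2) (.of_forall fun y => ?_)).trans ?_
    · have hneg : inner ℝ (w y) (∇ (fun y => 1 - θ k y) y) = -inner ℝ (w y) (∇ (θ k) y) := by
        rw [inner_gradient_eq_fderiv, inner_gradient_eq_fderiv, fderiv_const_sub]
        simp
      rw [hneg, norm_neg]
      by_cases hy : y ∈ T k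
      · refine (norm_inner_le_norm _ _).trans ?_
        simp only [Pi.add_apply, indicator_of_mem hy]
        have hsq : 0 ≤ ε⁻¹ * (‖w y‖ - ε * ‖∇ (θ k) y‖) ^ 2 := by positivity
        have hexp : ε⁻¹ * (‖w y‖ - ε * ‖∇ (θ k) y‖) ^ 2
            = ε⁻¹ * ‖w y‖ ^ 2 + ε * ‖∇ (θ k) y‖ ^ 2 - 2 * (‖w y‖ * ‖∇ (θ k) y‖) := by
          field_simp
          ring
        have hnn : 0 ≤ ‖w y‖ * ‖∇ (θ k) y‖ := by positivity
        linarith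
      · rw [hgrad0 k y hy, inner_zero_right, norm_zero, Pi.add_apply, indicator_of_notMem hy]
        positivity
    · simp only [Pi.add_apply]
      rw [integral_add hi1 hi2, integral_const_mul, integral_const_mul]
      gcongr
      exact (setIntegral_le_integral (hg2 k) (.of_forall fun y => sq_nonneg _)).trans (hdir k)
  have hle : ∀ ε : ℝ, 0 < ε → |∫ y, h y ∂surfaceMeasure Ω| ≤ ε * C := fun ε hε => by
    have := le_of_tendsto_of_tendsto' hlim.abs ((hsmall.const_mul ε⁻¹).add_const (ε * C))
      (hbound ε hε)
    simpa using this
  have hlim0 : Tendsto (fun ε : ℝ => ε * C) (𝓝[>] 0) (𝓝 0) := by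
    have : Tendsto (fun ε : ℝ => ε * C) (𝓝 0) (𝓝 (0 * C)) := tendsto_id.mul_const C
    rw [zero_mul] at this
    exact this.mono_left nhdsWithin_le_nhds
  exact abs_eq_zero.1 (le_antisymm (ge_of_tendsto hlim0 (eventually_mem_nhdsWithin.mono hle))
    (abs_nonneg _))

end Global

end BarusFlow

/-! ### Reciprocity -/

namespace BarusFlow

section Reciprocity

variable {d : ℕ} {Ω S : Set (Space d)}

/-- A bound inside `Ω` persists at the boundary points of continuity. -/
theorem abs_le_of_continuousWithinAt_closure {p : Space d → ℝ} {M : ℝ} (hM : ∀ x ∈ Ω, |p x| ≤ M)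
    {x : Space d} (hx : x ∈ closure Ω) (hp : ContinuousWithinAt p (closure Ω) x) : |p x| ≤ M := by
  have : (𝓝[Ω] x).NeBot := mem_closure_iff_nhdsWithin_neBot.1 hx
  exact le_of_tendsto (hp.mono subset_closure).abs (eventually_mem_nhdsWithin.mono hM)

theorem integrable_fluidity_mul {β p₀ : ℝ} {p q : Space d → ℝ} {M : ℝ}
    (hM : ∀ x ∈ Ω, |p x| ≤ M) (hSc : IsClosed S) (hS0 : surfaceMeasure Ω S = 0)
    (hp : ∀ x ∈ frontier Ω \ S, ContinuousWithinAt p (closure Ω) x)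
    (hq : Integrable q (surfaceMeasure Ω)) :
    Integrable (fun x => fluidity β p₀ (p x) * q x) (surfaceMeasure Ω) := by
  have hmem : ∀ᵐ x ∂surfaceMeasure Ω, x ∈ frontier Ω \ S := by
    filter_upwards [measure_eq_zero_iff_ae_notMem.1 hS0,
      ae_restrict_mem isClosed_frontier.measurableSet] with x h1 h2 using ⟨h2, h1⟩
  have hpc : ContinuousOn p (frontier Ω \ S) := fun x hx =>
    (hp x hx).mono (sdiff_subset.trans frontier_subset_closure)
  have hpm : AEStronglyMeasurable p (surfaceMeasure Ω) := by
    rw [← Measure.restrict_eq_self_of_ae_mem hmem]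
    exact hpc.aestronglyMeasurable (isClosed_frontier.measurableSet.diff hSc.measurableSet)
  obtain ⟨C, hC⟩ := exists_fluidity_bound β p₀ M
  refine hq.bdd_mul (c := C)
    ((contDiff_fluidity β p₀).continuous.comp_aestronglyMeasurable hpm) ?_
  filter_upwards [hmem] with x hx
  exact hC _ (abs_le_of_continuousWithinAt_closure hM (frontier_subset_closure hx.1) (hp x hx))

/-- The total flux of `reciprocalFlux` through the boundary vanishes. -/
theorem integral_fluidity_mul_flux_sub_eq_zero (hΩ : IsBoundedLipschitzDomain Ω)
    {μ₀ β p₀ : ℝ} {ξ : Space d → ℝ} {K : Space d → Matrix (Fin d) (Fin d) ℝ}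
    (hK : IsPermeability Ω K) {Γp Γv : Set (Space d)}
    {pp₁ pp₂ vn₁ vn₂ p₁ p₂ : Space d → ℝ} {v₁ v₂ : Space d → Space d}
    (h₁ : IsBarusSolution Ω μ₀ β p₀ ξ K Γp Γv pp₁ vn₁ p₁ v₁)
    (h₂ : IsBarusSolution Ω μ₀ β p₀ ξ K Γp Γv pp₂ vn₂ p₂ v₂) :
    Integrable (fun x => fluidity β p₀ (p₂ x) * inner ℝ (v₁ x) (outwardNormal Ω x))
        (surfaceMeasure Ω) ∧
      Integrable (fun x => fluidity β p₀ (p₁ x) * inner ℝ (v₂ x) (outwardNormal Ω x))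
        (surfaceMeasure Ω) ∧
      ∫ x, (fluidity β p₀ (p₂ x) * inner ℝ (v₁ x) (outwardNormal Ω x)
        - fluidity β p₀ (p₁ x) * inner ℝ (v₂ x) (outwardNormal Ω x)) ∂surfaceMeasure Ω = 0 := by
  obtain ⟨S₁, hc₁, hs₁, hf₁, hb₁⟩ := h₁.boundary
  obtain ⟨S₂, hc₂, hs₂, hf₂, hb₂⟩ := h₂.boundary
  obtain ⟨M₁, hM₁⟩ := h₁.bounded_p
  obtain ⟨M₂, hM₂⟩ := h₂.bounded_p
  have i₁ : Integrable (fun x => fluidity β p₀ (p₂ x) * inner ℝ (v₁ x) (outwardNormal Ω x))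
      (surfaceMeasure Ω) := integrable_fluidity_mul hM₂ hc₂
    (surfaceMeasure_eq_zero_of_hausdorffMeasure_lt_top hs₂ hf₂) (fun x hx => (hb₂ x hx).1)
    h₁.integrable_flux
  have i₂ : Integrable (fun x => fluidity β p₀ (p₁ x) * inner ℝ (v₂ x) (outwardNormal Ω x))
      (surfaceMeasure Ω) := integrable_fluidity_mul hM₁ hc₁
    (surfaceMeasure_eq_zero_of_hausdorffMeasure_lt_top hs₁ hf₁) (fun x hx => (hb₁ x hx).1)
    h₂.integrable_flux
  refine ⟨i₁, i₂, ?_⟩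
  have hnormal : ∀ x, inner ℝ (reciprocalFlux β p₀ p₁ p₂ v₁ v₂ x) (outwardNormal Ω x)
      = fluidity β p₀ (p₂ x) * inner ℝ (v₁ x) (outwardNormal Ω x)
        - fluidity β p₀ (p₁ x) * inner ℝ (v₂ x) (outwardNormal Ω x) := fun x => by
    rw [reciprocalFlux, inner_sub_left, real_inner_smul_left, real_inner_smul_left]
  have hFc := (contDiff_fluidity β p₀).continuous
  have key := integral_flux_eq_zero (w := reciprocalFlux β p₀ p₁ p₂ v₁ v₂) hΩ
    (hc₁.union hc₂) (union_subset hs₁ hs₂) (measure_union_lt_top hf₁ hf₂)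
    (memLp_reciprocalFlux hΩ.isOpen h₁ h₂)
    (fun φ hφ => integral_inner_reciprocalFlux_gradient hΩ.isOpen hK.symm h₁ h₂ hφ)
    (fun x hx => by
      obtain ⟨hp₁, hv₁⟩ := hb₁ x ⟨hx.1, fun h => hx.2 (Or.inl h)⟩
      obtain ⟨hp₂, hv₂⟩ := hb₂ x ⟨hx.1, fun h => hx.2 (Or.inr h)⟩
      exact ((hFc.continuousAt.comp_continuousWithinAt hp₂).smul hv₁).sub
        ((hFc.continuousAt.comp_continuousWithinAt hp₁).smul hv₂))
    ((i₁.sub i₂).congr (.of_forall fun x => (hnormal x).symm))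
  simpa only [hnormal] using key

theorem integral_surfaceMeasure_eq_add {Γp Γv : Set (Space d)} (hΓv : MeasurableSet Γv)
    (hunion : Γp ∪ Γv = frontier Ω) (hinter : Γp ∩ Γv = ∅) {f : Space d → ℝ}
    (hf : Integrable f (surfaceMeasure Ω)) :
    ∫ x, f x ∂surfaceMeasure Ω
      = (∫ x in Γp, f x ∂surfaceMeasure Ω) + ∫ x in Γv, f x ∂surfaceMeasure Ω := by
  rw [← setIntegral_union (disjoint_iff_inter_eq_empty.2 hinter) hΓv hf.integrableOn
    hf.integrableOn, hunion, surfaceMeasure,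
    Measure.restrict_eq_self_of_ae_mem (ae_restrict_mem isClosed_frontier.measurableSet)]

end Reciprocity

end BarusFlow

theorem mainTheorem5 {d : ℕ} (Ω : Set (BarusFlow.Space d))
    (hΩ : BarusFlow.IsBoundedLipschitzDomain Ω)
    (Γp Γv : Set (BarusFlow.Space d)) (hΓp : MeasurableSet Γp) (hΓv : MeasurableSet Γv)
    (hunion : Γp ∪ Γv = frontier Ω) (hinter : Γp ∩ Γv = ∅)
    (μ₀ β p₀ : ℝ) (hμ₀ : 0 < μ₀) (hβ : 0 ≤ β) (hp₀ : p₀ ≠ 0)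
    (ξ : BarusFlow.Space d → ℝ)
    (K : BarusFlow.Space d → Matrix (Fin d) (Fin d) ℝ) (hK : BarusFlow.IsPermeability Ω K)
    (pp₁ pp₂ vn₁ vn₂ : BarusFlow.Space d → ℝ)
    (p₁ p₂ : BarusFlow.Space d → ℝ) (v₁ v₂ : BarusFlow.Space d → BarusFlow.Space d)
    (h₁ : BarusFlow.IsBarusSolution Ω μ₀ β p₀ ξ K Γp Γv pp₁ vn₁ p₁ v₁)
    (h₂ : BarusFlow.IsBarusSolution Ω μ₀ β p₀ ξ K Γp Γv pp₂ vn₂ p₂ v₂) :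
    (∫ x in Γv, vn₂ x * Real.exp (-(β * (p₁ x / p₀ - 1))) ∂(BarusFlow.surfaceMeasure Ω))
      - ∫ x in Γp, Real.exp (-(β * (pp₂ x / p₀ - 1))) *
          inner ℝ (v₁ x) (BarusFlow.outwardNormal Ω x) ∂(BarusFlow.surfaceMeasure Ω)
    = (∫ x in Γv, vn₁ x * Real.exp (-(β * (p₂ x / p₀ - 1))) ∂(BarusFlow.surfaceMeasure Ω))
      - ∫ x in Γp, Real.exp (-(β * (pp₁ x / p₀ - 1))) *
          inner ℝ (v₂ x) (BarusFlow.outwardNormal Ω x) ∂(BarusFlow.surfaceMeasure Ω) := by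
  obtain ⟨i₁, i₂, h0⟩ := BarusFlow.integral_fluidity_mul_flux_sub_eq_zero hΩ hK h₁ h₂
  rw [integral_sub i₁ i₂, BarusFlow.integral_surfaceMeasure_eq_add hΓv hunion hinter i₁,
    BarusFlow.integral_surfaceMeasure_eq_add hΓv hunion hinter i₂] at h0
  have a₁ : ∫ x in Γv, vn₁ x * Real.exp (-(β * (p₂ x / p₀ - 1))) ∂(BarusFlow.surfaceMeasure Ω)
      = ∫ x in Γv, BarusFlow.fluidity β p₀ (p₂ x) *
          inner ℝ (v₁ x) (BarusFlow.outwardNormal Ω x) ∂(BarusFlow.surfaceMeasure Ω) := by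
    refine integral_congr_ae ?_
    filter_upwards [h₁.velocity_bc] with x hx
    rw [hx, BarusFlow.fluidity, mul_comm]
  have a₂ : ∫ x in Γv, vn₂ x * Real.exp (-(β * (p₁ x / p₀ - 1))) ∂(BarusFlow.surfaceMeasure Ω)
      = ∫ x in Γv, BarusFlow.fluidity β p₀ (p₁ x) *
          inner ℝ (v₂ x) (BarusFlow.outwardNormal Ω x) ∂(BarusFlow.surfaceMeasure Ω) := by
    refine integral_congr_ae ?_
    filter_upwards [h₂.velocity_bc] with x hx
    rw [hx, BarusFlow.fluidity, mul_comm]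
  have b₁ : ∫ x in Γp, Real.exp (-(β * (pp₂ x / p₀ - 1))) *
        inner ℝ (v₁ x) (BarusFlow.outwardNormal Ω x) ∂(BarusFlow.surfaceMeasure Ω)
      = ∫ x in Γp, BarusFlow.fluidity β p₀ (p₂ x) *
          inner ℝ (v₁ x) (BarusFlow.outwardNormal Ω x) ∂(BarusFlow.surfaceMeasure Ω) := by
    refine integral_congr_ae ?_
    filter_upwards [h₂.pressure_bc] with x hx
    rw [BarusFlow.fluidity, hx]
  have b₂ : ∫ x in Γp, Real.exp (-(β * (pp₁ x / p₀ - 1))) *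
        inner ℝ (v₂ x) (BarusFlow.outwardNormal Ω x) ∂(BarusFlow.surfaceMeasure Ω)
      = ∫ x in Γp, BarusFlow.fluidity β p₀ (p₁ x) *
          inner ℝ (v₂ x) (BarusFlow.outwardNormal Ω x) ∂(BarusFlow.surfaceMeasure Ω) := by
    refine integral_congr_ae ?_
    filter_upwards [h₁.pressure_bc] with x hx
    rw [BarusFlow.fluidity, hx]
  rw [a₁, a₂, b₁, b₂]
  linarith
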